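/- For $a,b,c\in\mathbb C$ let $$H_5(a,b,c|x,y)=\sum_{m,n\ge 0}\frac{(a)_{2m+n}(b)_{n-m}}{(c)_n\,m!\,n!}x^my^n,\qquad (b)_k=\frac{\Gamma(b+k)}{\Gamma(b)}\ (k\in\mathbb Z),$$ and, with $\theta_x=x\,\partial/\partial x$ and $\theta_y=y\,\partial/\partial y$, consider for $r\in\mathbb C$ the Horn system of $H_5(r,-r,\tfrac12|x,y)$: $$\bigl(\theta_x(-\theta_x+\theta_y-r)-x(2\theta_x+\theta_y+r)(2\theta_x+\theta_y+r+1)\bigr)F=0,$$ $$\bigl(\theta_y(\theta_y-\tfrac12)-y(2\theta_x+\theta_y+r)(-\theta_x+\theta_y-r)\bigr)F=0.$$ (1) Let $f$ be a holomorphic function on an open set $U\subseteq\mathbb C^2$ with $$x^2f^4+2xf^3+(1-2x)f^2+(4y-2)f+1=0 ,$$ and let $L$ be a holomorphic logarithm of $f$ on $U$. Then for every $r\in\mathbb C$ the function $f^r=e^{rL}$ solves the Horn system on $U$. (2) There is an $\varepsilon>0$, independent of $r$, such that the following holds; powers and square roots are principal branches. (a) On $D=\{(x,y): |x|,|y|<\varepsilon,\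 y\notin(-\infty,0]\}$ there is exactly one holomorphic solution $f$ of the quartic with $f=1+2i\sqrt y+O(|x|+|y|)$ as $(x,y)\to(0,0)$ in $D$. (b) Let $r\in\mathbb C$ with $2r\notin\mathbb Z$, and put $$\Phi_1=H_5(r,-r,\tfrac12|x,y),\qquad \Phi_2=\sqrt y\,H_5(r+\tfrac12,-r+\tfrac12,\tfrac32|x,y),$$ $$\Phi_3=x^{-r}\sum_{m,n\ge0}\frac{(-r)_{2m+3n}}{(\frac12)_n(1-r)_{m+n}\,m!\,n!}(-x)^m(xy)^n,$$ $$\Phi_4=x^{-r+\frac12}\sqrt y\sum_{m,n\ge0}\frac{(\frac32-r)_{2m+3n}}{(\frac32-r)_{m+n}(\frac32)_n\,m!\,n!}(-x)^m(xy)^n .$$ The four double series converge absolutely for $|x|,|y|<\varepsilon$. On every non-empty connected open set $U\subseteq\{(x,y)\in D: x\notin(-\infty,0]\}$ the functions $\Phi_1,\Phi_2,\Phi_3,\Phi_4$ form a basis of the space of holomorphic solutions of the Horn system, which therefore has rank $4$. With $f$ as in (a), the function $f^r$ solves the Horn system on $D$, and $$f^r=\Phi_1+2ir\,\Phi_2\qquad\text{on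 } D.$$ -/

import Mathlib

namespace HornH5

/-- The Euler operator `θ_x = x ∂/∂x`. -/
noncomputable def thetaX (F : ℂ × ℂ → ℂ) (p : ℂ × ℂ) : ℂ :=
  p.1 * deriv (fun t => F (t, p.2)) p.1

/-- The Euler operator `θ_y = y ∂/∂y`. -/
noncomputable def thetaY (F : ℂ × ℂ → ℂ) (p : ℂ × ℂ) : ℂ :=
  p.2 * deriv (fun t => F (p.1, t)) p.2

/-- The first order operator `α θ_x + β θ_y + γ`. -/
noncomputable def thetaLin (α β γ : ℂ) (F : ℂ × ℂ → ℂ) (p : ℂ × ℂ) : ℂ :=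
  α * thetaX F p + β * thetaY F p + γ * F p

/-- `F` is a holomorphic solution on `U` of the Horn system of `H₅(a, b, c | x, y)`:
`(θ_x (-θ_x + θ_y + b) - x (2θ_x + θ_y + a) (2θ_x + θ_y + a + 1)) F = 0` and
`(θ_y (θ_y + c - 1) - y (2θ_x + θ_y + a) (-θ_x + θ_y + b)) F = 0`. -/
structure IsHornSolution (a b c : ℂ) (U : Set (ℂ × ℂ)) (F : ℂ × ℂ → ℂ) : Prop where
  analytic : AnalyticOnNhd ℂ F U
  eq_x : ∀ p ∈ U, thetaX (thetaLin (-1) 1 b F) p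
    - p.1 * thetaLin 2 1 a (thetaLin 2 1 (a + 1) F) p = 0
  eq_y : ∀ p ∈ U, thetaY (thetaLin 0 1 (c - 1) F) p
    - p.2 * thetaLin 2 1 a (thetaLin (-1) 1 b F) p = 0

/-- The Pochhammer symbol `(b)_n = b (b + 1) ⋯ (b + n - 1)`. -/
noncomputable def poch (b : ℂ) (n : ℕ) : ℂ := (ascPochhammer ℂ n).eval b

/-- The Pochhammer symbol `(b)_k = Γ(b + k) / Γ(b)` for an integer `k`; in particular
`(b)_{-k} = 1 / ((b - k) (b - k + 1) ⋯ (b - 1)) = 1 / (b - k)_k` for `k > 0`. -/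
noncomputable def pochInt (b : ℂ) : ℤ → ℂ
  | Int.ofNat n => poch b n
  | Int.negSucc n => (poch (b - (n + 1)) (n + 1))⁻¹

/-- The `(m, n)` term of the Horn series `H₅(a, b, c | x, y)`. -/
noncomputable def H5Term (a b c x y : ℂ) (k : ℕ × ℕ) : ℂ :=
  poch a (2 * k.1 + k.2) * pochInt b ((k.2 : ℤ) - (k.1 : ℤ))
    / (poch c k.2 * (k.1.factorial : ℂ) * (k.2.factorial : ℂ)) * x ^ k.1 * y ^ k.2

/-- The Horn function `H₅(a, b, c | x, y)`. -/
noncomputable def H5 (a b c x y : ℂ) : ℂ := ∑' k : ℕ × ℕ, H5Term a b c x y k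

/-- The `(m, n)` term of the series in `Φ₃`. -/
noncomputable def Phi3Term (r x y : ℂ) (k : ℕ × ℕ) : ℂ :=
  poch (-r) (2 * k.1 + 3 * k.2)
    / (poch (1 / 2) k.2 * poch (1 - r) (k.1 + k.2) * (k.1.factorial : ℂ) * (k.2.factorial : ℂ))
    * (-x) ^ k.1 * (x * y) ^ k.2

/-- The `(m, n)` term of the series in `Φ₄`. -/
noncomputable def Phi4Term (r x y : ℂ) (k : ℕ × ℕ) : ℂ :=
  poch (3 / 2 - r) (2 * k.1 + 3 * k.2)
    / (poch (3 / 2 - r) (k.1 + k.2) * poch (3 / 2) k.2 * (k.1.factorial : ℂ)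
      * (k.2.factorial : ℂ))
    * (-x) ^ k.1 * (x * y) ^ k.2

/-- `Φ₁ = H₅(r, -r, 1/2 | x, y)`. -/
noncomputable def Phi1 (r : ℂ) (p : ℂ × ℂ) : ℂ := H5 r (-r) (1 / 2) p.1 p.2

/-- `Φ₂ = √y H₅(r + 1/2, -r + 1/2, 3/2 | x, y)`, with the principal square root. -/
noncomputable def Phi2 (r : ℂ) (p : ℂ × ℂ) : ℂ :=
  p.2 ^ (1 / 2 : ℂ) * H5 (r + 1 / 2) (-r + 1 / 2) (3 / 2) p.1 p.2

/-- `Φ₃`, with the principal branch of `x ^ (-r)`. -/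
noncomputable def Phi3 (r : ℂ) (p : ℂ × ℂ) : ℂ :=
  p.1 ^ (-r) * ∑' k : ℕ × ℕ, Phi3Term r p.1 p.2 k

/-- `Φ₄`, with the principal branches of `x ^ (-r + 1/2)` and `√y`. -/
noncomputable def Phi4 (r : ℂ) (p : ℂ × ℂ) : ℂ :=
  p.1 ^ (-r + 1 / 2) * p.2 ^ (1 / 2 : ℂ) * ∑' k : ℕ × ℕ, Phi4Term r p.1 p.2 k

/-- The four functions `Φ₁, Φ₂, Φ₃, Φ₄`. -/
noncomputable def Phi (r : ℂ) : Fin 4 → ℂ × ℂ → ℂ := ![Phi1 r, Phi2 r, Phi3 r, Phi4 r]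

/-- `z` is a root of `x² z⁴ + 2 x z³ + (1 - 2x) z² + (4y - 2) z + 1`. -/
def IsQuarticRoot (p : ℂ × ℂ) (z : ℂ) : Prop :=
  p.1 ^ 2 * z ^ 4 + 2 * p.1 * z ^ 3 + (1 - 2 * p.1) * z ^ 2 + (4 * p.2 - 2) * z + 1 = 0

/-- The points `(x, y)` with `|x|, |y| < ε` at which the principal `√y` is holomorphic. -/
def domY (ε : ℝ) : Set (ℂ × ℂ) :=
  {p | ‖p.1‖ < ε ∧ ‖p.2‖ < ε ∧ p.2 ∈ Complex.slitPlane}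

/-- The points of `domY ε` at which the principal powers of `x` are holomorphic as well. -/
def domXY (ε : ℝ) : Set (ℂ × ℂ) :=
  {p | p ∈ domY ε ∧ p.1 ∈ Complex.slitPlane}

/-- `f` is the holomorphic root of the quartic on `domY ε` with
`f = 1 + 2i√y + O(|x| + |y|)` at the origin. The quartic has two roots near `1` when
`(x, y)` is small, and they are exchanged by `√y ↦ -√y`. -/
structure IsRootBranch (ε : ℝ) (f : ℂ × ℂ → ℂ) : Prop where
  analytic : AnalyticOnNhd ℂ f (domY ε)
  root : ∀ p ∈ domY ε, IsQuarticRoot p (f p)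
  expansion : (fun p : ℂ × ℂ => f p - (1 + 2 * Complex.I * p.2 ^ (1 / 2 : ℂ)))
    =O[nhdsWithin 0 (domY ε)] (fun p : ℂ × ℂ => ‖p.1‖ + ‖p.2‖)

end HornH5

/-!
At a root `z` of the quartic, `w = x z² + z - 1` satisfies `w² = -4 y z`, so the logarithmic
derivatives of a root `f` are rational in `x`, `f` and `w` with the common denominator
`S = 3 x f² + f + 1`. The first order factors of the Horn operators therefore send `f ^ r` to
multiples of `f ^ r / S`, and both equations become polynomial identities modulo the quartic.

The coefficients of each `Φ_i` satisfy the two first order recurrences which express the Horn system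
termwise. Conversely, the system and its first derivatives determine all derivatives of a solution
from `F, θ_x F, θ_y F, θ_x θ_y F`, as long as the coefficient matrices of the operators are
invertible, which they are near the origin. So the solution space has dimension at most `4`, and the
`Φ_i` form a basis as soon as they are linearly independent. In the coordinates `x` and `s = √y`
they are powers of `x` with exponents `0, 0, -r, -r + 1/2` times holomorphic functions. Continuation
around `x = 0` separates the exponents, which are distinct modulo `ℤ` up to the repetition of `0`,
and the value and the `s`-derivative at the origin separate `Φ₁` from `Φ₂`.

In the same coordinates `f = v²` with `v` a holomorphic solution of `x v⁴ + v² - 1 = 2 i s v` and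
`v = 1` at the origin, because the quartic for `v²` is the product of this equation and the one with
`-s` for `s`. So `f ^ r` is holomorphic in `x` and `s`, hence a combination of `Φ₁` and `Φ₂`, whose
coefficients are the value and the `s`-derivative of `v ^ (2 r)` at the origin.
-/

namespace HornH5

open Filter Topology

section Theta

variable {F G : ℂ × ℂ → ℂ} {p : ℂ × ℂ} (α β γ α' β' γ' : ℂ)

theorem thetaX_eq_thetaLin (F : ℂ × ℂ → ℂ) : thetaX F = thetaLin 1 0 0 F := by
  ext p; simp [thetaLin]

theorem thetaY_eq_thetaLin (F : ℂ × ℂ → ℂ) : thetaY F = thetaLin 0 1 0 F := by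
  ext p; simp [thetaLin]

theorem hasDerivAt_slice_fst (h : DifferentiableAt ℂ F p) :
    HasDerivAt (fun t => F (t, p.2)) (fderiv ℂ F p (1, 0)) p.1 :=
  HasFDerivAt.comp_hasDerivAt (x := p.1) (f := fun t => (t, p.2)) h.hasFDerivAt
    ((hasDerivAt_id p.1).prodMk (hasDerivAt_const p.1 p.2))

theorem hasDerivAt_slice_snd (h : DifferentiableAt ℂ F p) :
    HasDerivAt (fun t => F (p.1, t)) (fderiv ℂ F p (0, 1)) p.2 :=
  HasFDerivAt.comp_hasDerivAt (x := p.2) (f := fun t => (p.1, t)) h.hasFDerivAt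
    ((hasDerivAt_const p.2 p.1).prodMk (hasDerivAt_id p.2))

theorem thetaLin_eq_fderiv (h : DifferentiableAt ℂ F p) :
    thetaLin α β γ F p = fderiv ℂ F p (α * p.1, β * p.2) + γ * F p := by
  have hv : (α * p.1, β * p.2) = (α * p.1) • ((1 : ℂ), (0 : ℂ)) + (β * p.2) • (0, 1) := by simp
  rw [thetaLin, thetaX, thetaY, (hasDerivAt_slice_fst h).deriv, (hasDerivAt_slice_snd h).deriv,
    hv, map_add, map_smul, map_smul, smul_eq_mul, smul_eq_mul, mul_assoc, mul_assoc]

theorem thetaLin_congr (h : F =ᶠ[𝓝 p] G) : thetaLin α β γ F p = thetaLin α β γ G p := by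
  have hx : Tendsto (fun t : ℂ => (t, p.2)) (𝓝 p.1) (𝓝 p) :=
    Continuous.tendsto (by fun_prop) p.1
  have hy : Tendsto (fun t : ℂ => (p.1, t)) (𝓝 p.2) (𝓝 p) :=
    Continuous.tendsto (by fun_prop) p.2
  have hdx : thetaX F p = thetaX G p := congrArg (p.1 * ·) (h.comp_tendsto hx).deriv_eq
  have hdy : thetaY F p = thetaY G p := congrArg (p.2 * ·) (h.comp_tendsto hy).deriv_eq
  rw [thetaLin, thetaLin, hdx, hdy, h.eq_of_nhds]

theorem thetaLin_eventuallyEq (h : F =ᶠ[𝓝 p] G) :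
    thetaLin α β γ F =ᶠ[𝓝 p] thetaLin α β γ G :=
  h.eventuallyEq_nhds.mono fun _ hq => thetaLin_congr α β γ hq

theorem thetaLin_eventuallyEq_fderiv (h : AnalyticAt ℂ F p) :
    thetaLin α β γ F =ᶠ[𝓝 p] fun q => fderiv ℂ F q (α * q.1, β * q.2) + γ * F q :=
  h.eventually_analyticAt.mono fun _ hq => thetaLin_eq_fderiv α β γ hq.differentiableAt

theorem analyticAt_thetaLin (h : AnalyticAt ℂ F p) : AnalyticAt ℂ (thetaLin α β γ F) p := by
  refine AnalyticAt.congr ?_ (thetaLin_eventuallyEq_fderiv α β γ h).symm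
  have hv : AnalyticAt ℂ (fun q : ℂ × ℂ => (α * q.1, β * q.2)) p :=
    (analyticAt_const.mul analyticAt_fst).prod (analyticAt_const.mul analyticAt_snd)
  exact ((ContinuousLinearMap.analyticAt_bilinear (.id ℂ (ℂ × ℂ →L[ℂ] ℂ)) _).comp₂ h.fderiv
    hv).add (analyticAt_const.mul h)

theorem differentiableAt_thetaLin (h : AnalyticAt ℂ F p) :
    DifferentiableAt ℂ (thetaLin α β γ F) p :=
  (analyticAt_thetaLin α β γ h).differentiableAt

theorem analyticAt_thetaX (h : AnalyticAt ℂ F p) : AnalyticAt ℂ (thetaX F) p := by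
  rw [thetaX_eq_thetaLin]; exact analyticAt_thetaLin _ _ _ h

theorem analyticAt_thetaY (h : AnalyticAt ℂ F p) : AnalyticAt ℂ (thetaY F) p := by
  rw [thetaY_eq_thetaLin]; exact analyticAt_thetaLin _ _ _ h

theorem thetaLin_const (c : ℂ) : thetaLin α β γ (fun _ => c) p = γ * c := by
  simp [thetaLin, thetaX, thetaY]

theorem thetaLin_fst : thetaLin α β γ Prod.fst p = (α + γ) * p.1 := by
  simp [thetaLin, thetaX, thetaY, add_mul]

theorem thetaLin_snd : thetaLin α β γ Prod.snd p = (β + γ) * p.2 := by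
  simp [thetaLin, thetaX, thetaY, add_mul]

theorem thetaLin_add (hF : DifferentiableAt ℂ F p) (hG : DifferentiableAt ℂ G p) :
    thetaLin α β γ (fun q => F q + G q) p = thetaLin α β γ F p + thetaLin α β γ G p := by
  rw [thetaLin_eq_fderiv _ _ _ (hF.fun_add hG), thetaLin_eq_fderiv _ _ _ hF,
    thetaLin_eq_fderiv _ _ _ hG, fderiv_fun_add hF hG, add_apply]
  ring

theorem thetaLin_mul (hF : DifferentiableAt ℂ F p) (hG : DifferentiableAt ℂ G p) :
    thetaLin α β γ (fun q => F q * G q) p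
      = thetaLin α β γ F p * G p + F p * thetaLin α β 0 G p := by
  rw [thetaLin_eq_fderiv _ _ _ (hF.fun_mul hG), thetaLin_eq_fderiv _ _ _ hF,
    thetaLin_eq_fderiv _ _ _ hG, fderiv_fun_mul hF hG]
  simp only [add_apply, smul_apply, smul_eq_mul]
  ring

theorem thetaLin_cexp (hF : DifferentiableAt ℂ F p) :
    thetaLin α β 0 (fun q => Complex.exp (F q)) p
      = thetaLin α β 0 F p * Complex.exp (F p) := by
  rw [thetaLin_eq_fderiv _ _ _ hF.cexp, thetaLin_eq_fderiv _ _ _ hF, hF.hasFDerivAt.cexp.fderiv]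
  simp only [smul_apply, smul_eq_mul]
  ring

theorem thetaLin_sum {ι : Type*} [Fintype ι] {F : ι → ℂ × ℂ → ℂ} (c : ι → ℂ)
    (hF : ∀ i, DifferentiableAt ℂ (F i) p) :
    thetaLin α β γ (fun q => ∑ i, c i * F i q) p = ∑ i, c i * thetaLin α β γ (F i) p := by
  have hc : ∀ i, DifferentiableAt ℂ (fun q => c i * F i q) p := fun i => (hF i).const_mul (c i)
  rw [thetaLin_eq_fderiv _ _ _ (DifferentiableAt.fun_sum fun i _ => hc i),
    fderiv_fun_sum fun i _ => hc i, sum_apply, Finset.mul_sum, ← Finset.sum_add_distrib]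
  refine Finset.sum_congr rfl fun i _ => ?_
  rw [fderiv_const_mul (hF i), thetaLin_eq_fderiv _ _ _ (hF i), smul_apply, smul_eq_mul]
  ring

theorem thetaLin_thetaLin_sum {ι : Type*} [Fintype ι] {F : ι → ℂ × ℂ → ℂ} (c : ι → ℂ)
    (hF : ∀ i, AnalyticAt ℂ (F i) p) :
    thetaLin α β γ (thetaLin α' β' γ' fun q => ∑ i, c i * F i q) p
      = ∑ i, c i * thetaLin α β γ (thetaLin α' β' γ' (F i)) p := by
  have hF' : ∀ᶠ q in 𝓝 p, ∀ i, AnalyticAt ℂ (F i) q :=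
    eventually_all.2 fun i => (hF i).eventually_analyticAt
  rw [thetaLin_congr _ _ _ (hF'.mono fun q hq =>
      thetaLin_sum α' β' γ' c fun i => (hq i).differentiableAt),
    thetaLin_sum _ _ _ _ fun i => differentiableAt_thetaLin _ _ _ (hF i)]

theorem thetaLin_thetaLin_eq_fderiv (h : AnalyticAt ℂ F p) :
    thetaLin α β γ (thetaLin α' β' γ' F) p
      = fderiv ℂ (fderiv ℂ F) p (α * p.1, β * p.2) (α' * p.1, β' * p.2)
        + fderiv ℂ F p (α' * (α * p.1), β' * (β * p.2))
        + γ' * fderiv ℂ F p (α * p.1, β * p.2)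
        + γ * thetaLin α' β' γ' F p := by
  have hv : HasFDerivAt (fun q : ℂ × ℂ => (α' * q.1, β' * q.2))
      ((α' • ContinuousLinearMap.fst ℂ ℂ ℂ).prod (β' • ContinuousLinearMap.snd ℂ ℂ ℂ)) p :=
    (hasFDerivAt_fst.const_mul α').prodMk (hasFDerivAt_snd.const_mul β')
  have hd := (h.fderiv.differentiableAt.hasFDerivAt.clm_apply hv).fun_add
    (h.differentiableAt.hasFDerivAt.const_mul γ')
  rw [thetaLin_eq_fderiv _ _ _ (differentiableAt_thetaLin α' β' γ' h),
    (thetaLin_eventuallyEq_fderiv α' β' γ' h).fderiv_eq, hd.fderiv]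
  simp
  ring

theorem thetaY_thetaX (h : AnalyticAt ℂ F p) : thetaY (thetaX F) p = thetaX (thetaY F) p := by
  have hs : IsSymmSndFDerivAt ℂ F p :=
    (h.contDiffAt (n := ⊤)).isSymmSndFDerivAt (by simp)
  rw [thetaX_eq_thetaLin F, thetaY_eq_thetaLin F, thetaX_eq_thetaLin, thetaY_eq_thetaLin,
    thetaLin_thetaLin_eq_fderiv _ _ _ _ _ _ h, thetaLin_thetaLin_eq_fderiv _ _ _ _ _ _ h, hs]
  simp

theorem thetaLin_thetaLin (h : AnalyticAt ℂ F p) :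
    thetaLin α β γ (thetaLin α' β' γ' F) p
      = α * α' * thetaX (thetaX F) p + (α * β' + α' * β) * thetaX (thetaY F) p
        + β * β' * thetaY (thetaY F) p + (α * γ' + α' * γ) * thetaX F p
        + (β * γ' + β' * γ) * thetaY F p + γ * γ' * F p := by
  have hsum := thetaLin_sum α β γ (F := ![thetaX F, thetaY F, F]) ![α', β', γ']
    (by intro i; fin_cases i <;> [exact (analyticAt_thetaX h).differentiableAt;
      exact (analyticAt_thetaY h).differentiableAt; exact h.differentiableAt])
  simp only [Fin.sum_univ_three, Matrix.cons_val] at hsum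
  change thetaLin α β γ (fun q => α' * thetaX F q + β' * thetaY F q + γ' * F q) p = _
  rw [hsum, thetaLin, thetaLin, thetaLin, thetaY_thetaX h]
  ring

theorem thetaLin_comm (h : AnalyticAt ℂ F p) :
    thetaLin α β γ (thetaLin α' β' γ' F) p = thetaLin α' β' γ' (thetaLin α β γ F) p := by
  rw [thetaLin_thetaLin _ _ _ _ _ _ h, thetaLin_thetaLin _ _ _ _ _ _ h]
  ring

end Theta

namespace IsHornSolution

variable {a b c : ℂ} {U V : Set (ℂ × ℂ)} {F G : ℂ × ℂ → ℂ}

theorem congr (hU : IsOpen U) (hF : IsHornSolution a b c U F) (h : Set.EqOn F G U) :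
    IsHornSolution a b c U G := by
  have hFG : ∀ p ∈ U, F =ᶠ[𝓝 p] G := fun p hp => h.eventuallyEq_of_mem (hU.mem_nhds hp)
  refine ⟨hF.analytic.congr hU h, fun p hp => ?_, fun p hp => ?_⟩
  · have := hF.eq_x p hp
    rwa [thetaX_eq_thetaLin, thetaLin_congr _ _ _ (thetaLin_eventuallyEq _ _ _ (hFG p hp)),
      thetaLin_congr _ _ _ (thetaLin_eventuallyEq _ _ _ (hFG p hp)), ← thetaX_eq_thetaLin] at this
  · have := hF.eq_y p hp
    rwa [thetaY_eq_thetaLin, thetaLin_congr _ _ _ (thetaLin_eventuallyEq _ _ _ (hFG p hp)),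
      thetaLin_congr _ _ _ (thetaLin_eventuallyEq _ _ _ (hFG p hp)), ← thetaY_eq_thetaLin] at this

theorem mono (hF : IsHornSolution a b c U F) (h : V ⊆ U) : IsHornSolution a b c V F :=
  ⟨hF.analytic.mono h, fun p hp => hF.eq_x p (h hp), fun p hp => hF.eq_y p (h hp)⟩

theorem sum {ι : Type*} [Fintype ι] {F : ι → ℂ × ℂ → ℂ}
    (hF : ∀ i, IsHornSolution a b c U (F i)) (d : ι → ℂ) :
    IsHornSolution a b c U (fun q => ∑ i, d i * F i q) := by
  have han : ∀ p ∈ U, ∀ i, AnalyticAt ℂ (F i) p := fun p hp i => (hF i).analytic p hp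
  refine ⟨fun p hp => ?_, fun p hp => ?_, fun p hp => ?_⟩
  · exact Finset.analyticAt_fun_sum _ fun i _ => analyticAt_const.mul (han p hp i)
  · rw [thetaX_eq_thetaLin, thetaLin_thetaLin_sum _ _ _ _ _ _ d (han p hp),
      thetaLin_thetaLin_sum _ _ _ _ _ _ d (han p hp), Finset.mul_sum, ← Finset.sum_sub_distrib]
    refine Finset.sum_eq_zero fun i _ => ?_
    rw [← thetaX_eq_thetaLin]
    linear_combination d i * (hF i).eq_x p hp
  · rw [thetaY_eq_thetaLin, thetaLin_thetaLin_sum _ _ _ _ _ _ d (han p hp),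
      thetaLin_thetaLin_sum _ _ _ _ _ _ d (han p hp), Finset.mul_sum, ← Finset.sum_sub_distrib]
    refine Finset.sum_eq_zero fun i _ => ?_
    rw [← thetaY_eq_thetaLin]
    linear_combination d i * (hF i).eq_y p hp

theorem sub (hF : IsHornSolution a b c U F) (hG : IsHornSolution a b c U G) :
    IsHornSolution a b c U (fun q => F q - G q) := by
  have h := sum (F := ![F, G]) (by intro i; fin_cases i <;> assumption) ![1, -1]
  simpa [Fin.sum_univ_two, sub_eq_add_neg] using h

end IsHornSolution

section RootPower

/-- The resolvent `x z² + z - 1`, whose square is `-4 y z` at a root `z` of the quartic. -/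
def resolvent (p : ℂ × ℂ) (z : ℂ) : ℂ := p.1 * z ^ 2 + z - 1

/-- The common denominator `3 x z² + z + 1` of the logarithmic derivatives of a root `z` of the
quartic. -/
def logDenom (p : ℂ × ℂ) (z : ℂ) : ℂ := 3 * p.1 * z ^ 2 + z + 1

theorem isQuarticRoot_iff {p : ℂ × ℂ} {z : ℂ} :
    IsQuarticRoot p z ↔ resolvent p z ^ 2 + 4 * p.2 * z = 0 := by
  rw [IsQuarticRoot, resolvent]
  constructor <;> intro h <;> linear_combination h

variable {L : ℂ × ℂ → ℂ} {p : ℂ × ℂ} (α β r : ℂ)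

theorem differentiableAt_resolvent (hL : DifferentiableAt ℂ L p) :
    DifferentiableAt ℂ (fun q => resolvent q (Complex.exp (L q))) p := by
  unfold resolvent; fun_prop

theorem differentiableAt_logDenom (hL : DifferentiableAt ℂ L p) :
    DifferentiableAt ℂ (fun q => logDenom q (Complex.exp (L q))) p := by
  unfold logDenom; fun_prop

theorem thetaLin_fst_mul_cexp_sq (hL : DifferentiableAt ℂ L p) :
    thetaLin α β 0 (fun q => q.1 * (Complex.exp (L q) * Complex.exp (L q))) p
      = (α + 2 * thetaLin α β 0 L p) * (p.1 * Complex.exp (L p) ^ 2) := by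
  rw [thetaLin_mul _ _ _ differentiableAt_fst (hL.cexp.fun_mul hL.cexp),
    thetaLin_mul _ _ _ hL.cexp hL.cexp, thetaLin_cexp _ _ hL, thetaLin_fst]
  ring

theorem thetaLin_resolvent (hL : DifferentiableAt ℂ L p) :
    thetaLin α β 0 (fun q => resolvent q (Complex.exp (L q))) p
      = (α + 2 * thetaLin α β 0 L p) * (p.1 * Complex.exp (L p) ^ 2)
        + thetaLin α β 0 L p * Complex.exp (L p) := by
  simp only [resolvent, sub_eq_add_neg, sq (Complex.exp (L _))]
  rw [thetaLin_add _ _ _ (by fun_prop) (by fun_prop),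
    thetaLin_add _ _ _ (by fun_prop) (by fun_prop), thetaLin_const,
    thetaLin_fst_mul_cexp_sq _ _ hL, thetaLin_cexp _ _ hL]
  ring

theorem thetaLin_logDenom (hL : DifferentiableAt ℂ L p) :
    thetaLin α β 0 (fun q => logDenom q (Complex.exp (L q))) p
      = 3 * ((α + 2 * thetaLin α β 0 L p) * (p.1 * Complex.exp (L p) ^ 2))
        + thetaLin α β 0 L p * Complex.exp (L p) := by
  simp only [logDenom, mul_assoc, sq (Complex.exp (L _))]
  rw [thetaLin_add _ _ _ (by fun_prop) (by fun_prop),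
    thetaLin_add _ _ _ (by fun_prop) (by fun_prop), thetaLin_const,
    thetaLin_mul _ _ _ (by fun_prop) (by fun_prop), thetaLin_const,
    thetaLin_fst_mul_cexp_sq _ _ hL, thetaLin_cexp _ _ hL]
  ring

theorem resolvent_ne_zero (hL : DifferentiableAt ℂ L p)
    (hroot : ∀ᶠ q in 𝓝 p, IsQuarticRoot q (Complex.exp (L q))) :
    resolvent p (Complex.exp (L p)) ≠ 0 := by
  intro hv
  have hy : p.2 = 0 := by
    simpa [hv, Complex.exp_ne_zero] using isQuarticRoot_iff.1 hroot.self_of_nhds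
  have hslice : Tendsto (fun t : ℂ => (p.1, t)) (𝓝 p.2) (𝓝 p) :=
    Continuous.tendsto (by fun_prop) p.2
  have hzero : (fun t => resolvent (p.1, t) (Complex.exp (L (p.1, t))) ^ 2
      + 4 * t * Complex.exp (L (p.1, t))) =ᶠ[𝓝 p.2] fun _ => 0 :=
    (hslice.eventually hroot).mono fun t ht => isQuarticRoot_iff.1 ht
  have hderiv := ((hasDerivAt_slice_snd (differentiableAt_resolvent hL)).fun_pow 2).fun_add
    (((hasDerivAt_id p.2).const_mul 4).fun_mul (hasDerivAt_slice_snd hL.cexp))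
  have h4 := (hderiv.congr_of_eventuallyEq hzero.symm).unique (hasDerivAt_const p.2 (0 : ℂ))
  simp only [Prod.mk.eta, hv] at h4
  simp [hy, Complex.exp_ne_zero] at h4

theorem logDenom_mul_thetaLin_log (hL : DifferentiableAt ℂ L p)
    (hroot : ∀ᶠ q in 𝓝 p, IsQuarticRoot q (Complex.exp (L q))) :
    logDenom p (Complex.exp (L p)) * thetaLin α β 0 L p
      = β * resolvent p (Complex.exp (L p)) - 2 * α * (p.1 * Complex.exp (L p) ^ 2) := by
  have hR := differentiableAt_resolvent hL
  have hzero : thetaLin α β 0 (fun q => resolvent q (Complex.exp (L q))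
      * resolvent q (Complex.exp (L q)) + 4 * (q.2 * Complex.exp (L q))) p = 0 := by
    rw [thetaLin_congr (G := fun _ => 0) _ _ _ (hroot.mono fun q hq => by
      linear_combination isQuarticRoot_iff.1 hq), thetaLin_const, mul_zero]
  rw [thetaLin_add _ _ _ (hR.fun_mul hR) (by fun_prop), thetaLin_mul _ _ _ hR hR,
    thetaLin_mul _ _ _ (by fun_prop) (by fun_prop), thetaLin_const,
    thetaLin_mul _ _ _ (by fun_prop) (by fun_prop), thetaLin_snd, thetaLin_cexp _ _ hL,
    thetaLin_resolvent _ _ hL] at hzero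
  refine mul_left_cancel₀ (resolvent_ne_zero hL hroot) ?_
  have hp := isQuarticRoot_iff.1 hroot.self_of_nhds
  rw [logDenom]
  simp only [resolvent] at hzero hp ⊢
  linear_combination hzero - (β + thetaLin α β 0 L p) * hp

theorem logDenom_ne_zero (hL : DifferentiableAt ℂ L p)
    (hroot : ∀ᶠ q in 𝓝 p, IsQuarticRoot q (Complex.exp (L q))) :
    logDenom p (Complex.exp (L p)) ≠ 0 := by
  intro h
  have := logDenom_mul_thetaLin_log 0 1 hL hroot
  rw [h] at this
  exact resolvent_ne_zero hL hroot (by linear_combination -this)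

theorem thetaLin_log (hL : DifferentiableAt ℂ L p)
    (hroot : ∀ᶠ q in 𝓝 p, IsQuarticRoot q (Complex.exp (L q))) :
    thetaLin α β 0 L p
      = (β * resolvent p (Complex.exp (L p)) - 2 * α * (p.1 * Complex.exp (L p) ^ 2))
        / logDenom p (Complex.exp (L p)) := by
  rw [eq_div_iff (logDenom_ne_zero hL hroot), mul_comm, logDenom_mul_thetaLin_log _ _ hL hroot]

/-- The function `f ^ r / (3 x f² + f + 1)` for `f = exp L`: the first order factors of the Horn
operators send `f ^ r` to simple multiples of it. -/
noncomputable def powDivLogDenom (r : ℂ) (L : ℂ × ℂ → ℂ) (p : ℂ × ℂ) : ℂ :=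
  Complex.exp (r * L p) / logDenom p (Complex.exp (L p))

theorem thetaLin_cexp_mul_log (γ : ℂ) (hL : DifferentiableAt ℂ L p)
    (hroot : ∀ᶠ q in 𝓝 p, IsQuarticRoot q (Complex.exp (L q))) :
    thetaLin α β γ (fun q => Complex.exp (r * L q)) p
      = (r * (β * resolvent p (Complex.exp (L p)) - 2 * α * (p.1 * Complex.exp (L p) ^ 2))
          + γ * logDenom p (Complex.exp (L p))) * powDivLogDenom r L p := by
  have hS := logDenom_ne_zero hL hroot
  have hsplit : thetaLin α β γ (fun q => Complex.exp (r * L q)) p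
      = thetaLin α β 0 (fun q => Complex.exp (r * L q)) p + γ * Complex.exp (r * L p) := by
    simp [thetaLin]
  rw [hsplit, thetaLin_cexp _ _ (hL.const_mul r), thetaLin_mul _ _ _ (by fun_prop) hL,
    thetaLin_const, ← logDenom_mul_thetaLin_log α β hL hroot, powDivLogDenom]
  field_simp
  ring

theorem thetaLin_neg_one_one_cexp_mul_log (hL : DifferentiableAt ℂ L p)
    (hroot : ∀ᶠ q in 𝓝 p, IsQuarticRoot q (Complex.exp (L q))) :
    thetaLin (-1) 1 (-r) (fun q => Complex.exp (r * L q)) p = -2 * r * powDivLogDenom r L p := by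
  rw [thetaLin_cexp_mul_log _ _ _ _ hL hroot, resolvent, logDenom]
  ring

theorem thetaLin_two_one_cexp_mul_log (hL : DifferentiableAt ℂ L p)
    (hroot : ∀ᶠ q in 𝓝 p, IsQuarticRoot q (Complex.exp (L q))) :
    thetaLin 2 1 r (fun q => Complex.exp (r * L q)) p
      = 2 * r * (Complex.exp (L p) * powDivLogDenom r L p) := by
  rw [thetaLin_cexp_mul_log _ _ _ _ hL hroot, resolvent, logDenom]
  ring

theorem thetaY_cexp_mul_log (hL : DifferentiableAt ℂ L p)
    (hroot : ∀ᶠ q in 𝓝 p, IsQuarticRoot q (Complex.exp (L q))) :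
    thetaY (fun q => Complex.exp (r * L q)) p
      = r * (resolvent p (Complex.exp (L p)) * powDivLogDenom r L p) := by
  rw [thetaY_eq_thetaLin, thetaLin_cexp_mul_log _ _ _ _ hL hroot]
  ring

theorem differentiableAt_powDivLogDenom (hL : DifferentiableAt ℂ L p)
    (hroot : ∀ᶠ q in 𝓝 p, IsQuarticRoot q (Complex.exp (L q))) :
    DifferentiableAt ℂ (powDivLogDenom r L) p := by
  unfold powDivLogDenom
  simp only [div_eq_mul_inv]
  exact (hL.const_mul r).cexp.fun_mul
    ((differentiableAt_logDenom hL).fun_inv (logDenom_ne_zero hL hroot))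

theorem thetaLin_powDivLogDenom (hL : DifferentiableAt ℂ L p)
    (hroot : ∀ᶠ q in 𝓝 p, IsQuarticRoot q (Complex.exp (L q))) :
    thetaLin α β 0 (powDivLogDenom r L) p
      = (r * thetaLin α β 0 L p
          - (3 * ((α + 2 * thetaLin α β 0 L p) * (p.1 * Complex.exp (L p) ^ 2))
            + thetaLin α β 0 L p * Complex.exp (L p)) / logDenom p (Complex.exp (L p)))
        * powDivLogDenom r L p := by
  have hS := logDenom_ne_zero hL hroot
  have hSd := differentiableAt_logDenom hL
  have hE : (fun q => powDivLogDenom r L q * logDenom q (Complex.exp (L q))) =ᶠ[𝓝 p]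
      fun q => Complex.exp (r * L q) :=
    (hSd.continuousAt.eventually_ne hS).mono fun q hq => div_mul_cancel₀ _ hq
  have h := thetaLin_congr α β 0 hE
  rw [thetaLin_mul _ _ _ (differentiableAt_powDivLogDenom r hL hroot) hSd,
    thetaLin_logDenom _ _ hL, thetaLin_cexp _ _ (hL.const_mul r),
    thetaLin_mul _ _ _ (by fun_prop) hL, thetaLin_const] at h
  have hp : powDivLogDenom r L p * logDenom p (Complex.exp (L p)) = Complex.exp (r * L p) :=
    hE.eq_of_nhds
  rw [← hp] at h
  field_simp
  linear_combination h

theorem horn_x_cexp_mul_log (hL : AnalyticAt ℂ L p)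
    (hroot : ∀ᶠ q in 𝓝 p, IsQuarticRoot q (Complex.exp (L q))) :
    thetaX (thetaLin (-1) 1 (-r) fun q => Complex.exp (r * L q)) p
      - p.1 * thetaLin 2 1 r (thetaLin 2 1 (r + 1) fun q => Complex.exp (r * L q)) p = 0 := by
  have hLd := hL.differentiableAt
  have hS := logDenom_ne_zero hLd hroot
  have hW := differentiableAt_powDivLogDenom r hLd hroot
  have hev := hroot.eventually_nhds.and hL.eventually_analyticAt
  have hx := hev.mono fun q hq =>
    thetaLin_neg_one_one_cexp_mul_log r hq.2.differentiableAt hq.1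
  have hxy := hev.mono fun q hq => thetaLin_two_one_cexp_mul_log r hq.2.differentiableAt hq.1
  have hsplit : ∀ G : ℂ × ℂ → ℂ, thetaLin 2 1 (r + 1) G p
      = thetaLin 2 1 0 G p + (r + 1) * G p := fun G => by simp [thetaLin]
  rw [thetaLin_comm _ _ _ _ _ _ ((analyticAt_const (v := r)).fun_mul hL).cexp', thetaX_eq_thetaLin,
    thetaLin_congr _ _ _ hx, thetaLin_congr _ _ _ hxy, hsplit,
    thetaLin_mul _ _ _ (by fun_prop) hW, thetaLin_const,
    thetaLin_mul _ _ _ (by fun_prop) (hLd.cexp.fun_mul hW), thetaLin_const,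
    thetaLin_mul _ _ _ hLd.cexp hW, thetaLin_cexp _ _ hLd,
    thetaLin_powDivLogDenom _ _ _ hLd hroot, thetaLin_powDivLogDenom _ _ _ hLd hroot,
    thetaLin_log _ _ hLd hroot, thetaLin_log _ _ hLd hroot]
  field_simp
  rw [resolvent, logDenom]
  ring

theorem horn_y_cexp_mul_log (hL : AnalyticAt ℂ L p)
    (hroot : ∀ᶠ q in 𝓝 p, IsQuarticRoot q (Complex.exp (L q))) :
    thetaY (thetaLin 0 1 (1 / 2 - 1) fun q => Complex.exp (r * L q)) p
      - p.2 * thetaLin 2 1 r (thetaLin (-1) 1 (-r) fun q => Complex.exp (r * L q)) p = 0 := by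
  have hLd := hL.differentiableAt
  have hS := logDenom_ne_zero hLd hroot
  have hW := differentiableAt_powDivLogDenom r hLd hroot
  have hR := differentiableAt_resolvent hLd
  have hev := hroot.eventually_nhds.and hL.eventually_analyticAt
  have hx := hev.mono fun q hq =>
    thetaLin_neg_one_one_cexp_mul_log r hq.2.differentiableAt hq.1
  have hy := hev.mono fun q hq => thetaY_cexp_mul_log r hq.2.differentiableAt hq.1
  have hsplit : ∀ (α γ : ℂ) (G : ℂ × ℂ → ℂ), thetaLin α 1 γ G p
      = thetaLin α 1 0 G p + γ * G p := fun α γ G => by simp [thetaLin]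
  rw [thetaY_eq_thetaLin] at hy
  rw [thetaY_eq_thetaLin, thetaLin_comm _ _ _ _ _ _ ((analyticAt_const (v := r)).fun_mul hL).cexp',
    thetaLin_congr _ _ _ hy, thetaLin_congr _ _ _ hx, hsplit, hsplit 2,
    thetaLin_mul _ _ _ (by fun_prop) (hR.fun_mul hW), thetaLin_const,
    thetaLin_mul _ _ _ hR hW, thetaLin_resolvent _ _ hLd,
    thetaLin_mul _ _ _ (by fun_prop) hW, thetaLin_const,
    thetaLin_powDivLogDenom _ _ _ hLd hroot, thetaLin_powDivLogDenom _ _ _ hLd hroot,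
    thetaLin_log _ _ hLd hroot, thetaLin_log _ _ hLd hroot]
  have hp := isQuarticRoot_iff.1 hroot.self_of_nhds
  field_simp
  rw [resolvent] at hp
  rw [resolvent, logDenom]
  linear_combination (r * (1 - Complex.exp (L p) - 9 * p.1 * Complex.exp (L p) ^ 2)
    + 2 * r ^ 2 * (3 * p.1 * Complex.exp (L p) ^ 2 + Complex.exp (L p) + 1))
      * powDivLogDenom r L p * hp

theorem isHornSolution_cexp_mul_log {U : Set (ℂ × ℂ)} (hU : IsOpen U) (hL : AnalyticOnNhd ℂ L U)
    (hroot : ∀ p ∈ U, IsQuarticRoot p (Complex.exp (L p))) :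
    IsHornSolution r (-r) (1 / 2) U (fun p => Complex.exp (r * L p)) := by
  have hroot' : ∀ p ∈ U, ∀ᶠ q in 𝓝 p, IsQuarticRoot q (Complex.exp (L q)) :=
    fun p hp => Filter.mem_of_superset (hU.mem_nhds hp) hroot
  exact ⟨fun p hp => (analyticAt_const.mul (hL p hp)).cexp,
    fun p hp => horn_x_cexp_mul_log r (hL p hp) (hroot' p hp),
    fun p hp => horn_y_cexp_mul_log r (hL p hp) (hroot' p hp)⟩

end RootPower

section DoubleSeries

open Finset.HasAntidiagonal (antidiagonal)

/-- The sum of the double power series with coefficients `a`. -/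
noncomputable def doubleSeries (a : ℕ × ℕ → ℂ) (p : ℂ × ℂ) : ℂ :=
  ∑' k : ℕ × ℕ, a k * p.1 ^ k.1 * p.2 ^ k.2

/-- The double power series with coefficients `a` converges absolutely for `|x|, |y| < R`. -/
def ConvergesBelow (R : ℝ) (a : ℕ × ℕ → ℂ) : Prop :=
  ∀ ρ : ℝ, 0 < ρ → ρ < R → Summable fun k : ℕ × ℕ => ‖a k‖ * ρ ^ (k.1 + k.2)

theorem summable_pow_add {ρ : ℝ} (h0 : 0 ≤ ρ) (h1 : ρ < 1) :
    Summable fun k : ℕ × ℕ => ρ ^ (k.1 + k.2) := by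
  have := (summable_geometric_of_lt_one h0 h1).mul_of_nonneg (summable_geometric_of_lt_one h0 h1)
    (fun _ => by positivity) (fun _ => by positivity)
  exact this.congr fun k => by rw [pow_add]

theorem convergesBelow_of_norm_le {K C : ℝ} (hK : 0 < K) {a : ℕ × ℕ → ℂ}
    (h : ∀ k, ‖a k‖ ≤ C * K ^ (k.1 + k.2)) : ConvergesBelow K⁻¹ a := by
  intro ρ h0 h1
  have hlt : K * ρ < 1 := by
    rwa [lt_inv_comm₀ h0 hK, ← one_div, lt_div_iff₀ h0] at h1
  refine Summable.of_nonneg_of_le (fun k => by positivity) (fun k => ?_)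
    ((summable_pow_add (by positivity) hlt).mul_left C)
  rw [mul_pow, ← mul_assoc]
  exact mul_le_mul_of_nonneg_right (h k) (by positivity)

theorem exists_succ_mul_pow_le {ρ ρ' : ℝ} (h0 : 0 < ρ) (h : ρ < ρ') :
    ∃ C : ℝ, ∀ n : ℕ, (n + 1) * ρ ^ n ≤ C * ρ' ^ n := by
  have hρ : ‖ρ‖ < ρ' := by rwa [Real.norm_of_nonneg h0.le]
  have hO : (fun n : ℕ => (n : ℝ) ^ 1 * ρ ^ n + (n : ℝ) ^ 0 * ρ ^ n) =O[atTop]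
      fun n => ρ' ^ n :=
    (isLittleO_pow_const_mul_const_pow_const_pow_of_norm_lt 1 hρ).isBigO.add
      (isLittleO_pow_const_mul_const_pow_const_pow_of_norm_lt 0 hρ).isBigO
  obtain ⟨C, -, hC⟩ := Asymptotics.bound_of_isBigO_nat_atTop hO
  refine ⟨C, fun n => ?_⟩
  have hpos : 0 < ρ' ^ n := pow_pos (h0.trans h) n
  have hn := hC (x := n) hpos.ne'
  rw [Real.norm_of_nonneg hpos.le] at hn
  calc ((n : ℝ) + 1) * ρ ^ n = (n : ℝ) ^ 1 * ρ ^ n + (n : ℝ) ^ 0 * ρ ^ n := by ring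
    _ ≤ C * ρ' ^ n := (Real.le_norm_self _).trans hn

theorem norm_affine_weight_le (α β γ : ℂ) (m n : ℕ) :
    ‖α * m + β * n + γ‖ ≤ (‖α‖ + ‖β‖ + ‖γ‖) * ((m + n : ℕ) + 1) := by
  calc ‖α * m + β * n + γ‖ ≤ ‖α‖ * m + ‖β‖ * n + ‖γ‖ * 1 := by
        simpa using norm_add₃_le (a := α * m) (b := β * n) (c := γ)
    _ ≤ ‖α‖ * ((m + n : ℕ) + 1) + ‖β‖ * ((m + n : ℕ) + 1) + ‖γ‖ * ((m + n : ℕ) + 1) := by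
        push_cast
        gcongr <;> linarith [m.cast_nonneg (α := ℝ), n.cast_nonneg (α := ℝ)]
    _ = _ := by ring

variable {R : ℝ} {a : ℕ × ℕ → ℂ}

theorem ConvergesBelow.summable_norm (h : ConvergesBelow R a) {x y : ℂ} (hx : ‖x‖ < R)
    (hy : ‖y‖ < R) : Summable fun k : ℕ × ℕ => ‖a k * x ^ k.1 * y ^ k.2‖ := by
  obtain ⟨ρ, h1, h2⟩ := exists_between (max_lt hx hy)
  have hρ : 0 < ρ := (norm_nonneg x).trans_lt ((le_max_left _ _).trans_lt h1)
  refine Summable.of_nonneg_of_le (fun k => norm_nonneg _) (fun k => ?_) (h ρ hρ h2)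
  rw [norm_mul, norm_mul, norm_pow, norm_pow, mul_assoc, pow_add]
  have hxρ := (le_max_left ‖x‖ ‖y‖).trans h1.le
  have hyρ := (le_max_right ‖x‖ ‖y‖).trans h1.le
  gcongr

theorem ConvergesBelow.summable (h : ConvergesBelow R a) {x y : ℂ} (hx : ‖x‖ < R)
    (hy : ‖y‖ < R) : Summable fun k : ℕ × ℕ => a k * x ^ k.1 * y ^ k.2 :=
  (h.summable_norm hx hy).of_norm

theorem ConvergesBelow.weight (h : ConvergesBelow R a) (α β γ : ℂ) :
    ConvergesBelow R fun k => (α * k.1 + β * k.2 + γ) * a k := by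
  intro ρ h0 h1
  obtain ⟨ρ', h2, h3⟩ := exists_between h1
  obtain ⟨C, hC⟩ := exists_succ_mul_pow_le h0 h2
  refine Summable.of_nonneg_of_le (fun k => by positivity) (fun k => ?_)
    ((h ρ' (h0.trans h2) h3).mul_left ((‖α‖ + ‖β‖ + ‖γ‖) * C))
  calc ‖(α * k.1 + β * k.2 + γ) * a k‖ * ρ ^ (k.1 + k.2)
      ≤ (‖α‖ + ‖β‖ + ‖γ‖) * ((k.1 + k.2 : ℕ) + 1) * ‖a k‖ * ρ ^ (k.1 + k.2) := by
        rw [norm_mul]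
        gcongr
        exact norm_affine_weight_le α β γ k.1 k.2
    _ = (‖α‖ + ‖β‖ + ‖γ‖) * ‖a k‖ * (((k.1 + k.2 : ℕ) + 1) * ρ ^ (k.1 + k.2)) := by ring
    _ ≤ (‖α‖ + ‖β‖ + ‖γ‖) * ‖a k‖ * (C * ρ' ^ (k.1 + k.2)) :=
        mul_le_mul_of_nonneg_left (hC _) (by positivity)
    _ = _ := by ring

/-- The monomial `x ^ m y ^ (N - m)` as a multilinear map. -/
noncomputable def monomialMultilinear (N m : ℕ) : (ℂ × ℂ) [×N]→L[ℂ] ℂ :=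
  (ContinuousMultilinearMap.mkPiAlgebra ℂ (Fin N) ℂ).compContinuousLinearMap fun i =>
    if (i : ℕ) < m then ContinuousLinearMap.fst ℂ ℂ ℂ else ContinuousLinearMap.snd ℂ ℂ ℂ

theorem monomialMultilinear_apply (m n : ℕ) (q : ℂ × ℂ) :
    monomialMultilinear (m + n) m (fun _ => q) = q.1 ^ m * q.2 ^ n := by
  have : monomialMultilinear (m + n) m (fun _ => q)
      = ∏ i : Fin (m + n), if (i : ℕ) < m then q.1 else q.2 := by
    simp only [monomialMultilinear, ContinuousMultilinearMap.compContinuousLinearMap_apply,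
      ContinuousMultilinearMap.mkPiAlgebra_apply]
    refine Finset.prod_congr rfl fun i _ => ?_
    split_ifs <;> rfl
  rw [this, Fin.prod_univ_eq_prod_range (fun i => if i < m then q.1 else q.2),
    Finset.prod_range_add]
  congr 1
  · rw [Finset.prod_congr rfl (g := fun _ => q.1)]
    · simp
    · intro i hi
      rw [if_pos (Finset.mem_range.1 hi)]
  · simp

theorem norm_monomialMultilinear_le (N m : ℕ) : ‖monomialMultilinear N m‖ ≤ 1 := by
  refine (ContinuousMultilinearMap.norm_compContinuousLinearMap_le _ _).trans ?_
  rw [ContinuousMultilinearMap.norm_mkPiAlgebra, one_mul]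
  refine Finset.prod_le_one (fun _ _ => norm_nonneg _) fun i _ => ?_
  split_ifs
  · exact ContinuousLinearMap.norm_fst_le ℂ ℂ ℂ
  · exact ContinuousLinearMap.norm_snd_le ℂ ℂ ℂ

/-- The formal multilinear series of a double power series. -/
noncomputable def doubleFormalSeries (a : ℕ × ℕ → ℂ) : FormalMultilinearSeries ℂ (ℂ × ℂ) ℂ :=
  fun N => ∑ k ∈ antidiagonal N, a k • monomialMultilinear N k.1

theorem doubleFormalSeries_apply (a : ℕ × ℕ → ℂ) (N : ℕ) (q : ℂ × ℂ) :
    doubleFormalSeries a N (fun _ => q)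
      = ∑ k ∈ antidiagonal N, a k * q.1 ^ k.1 * q.2 ^ k.2 := by
  simp only [doubleFormalSeries, sum_apply,
    smul_apply, smul_eq_mul]
  refine Finset.sum_congr rfl fun k hk => ?_
  obtain rfl := (Finset.HasAntidiagonal.mem_antidiagonal.1 hk)
  rw [monomialMultilinear_apply, mul_assoc]

theorem norm_doubleFormalSeries_le (a : ℕ × ℕ → ℂ) (N : ℕ) :
    ‖doubleFormalSeries a N‖ ≤ ∑ k ∈ antidiagonal N, ‖a k‖ := by
  refine (norm_sum_le _ _).trans (Finset.sum_le_sum fun k _ => ?_)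
  rw [norm_smul]
  exact mul_le_of_le_one_right (norm_nonneg _) (norm_monomialMultilinear_le _ _)

theorem hasSum_antidiagonal {E : Type*} [NormedAddCommGroup E] {g : ℕ × ℕ → E} {s : E}
    (h : HasSum g s) : HasSum (fun N => ∑ k ∈ antidiagonal N, g k) s := by
  have h' := Finset.HasAntidiagonal.sigmaAntidiagonalEquivProd.hasSum_iff.2 h
  refine h'.sigma fun N => ?_
  have := hasSum_fintype fun c : antidiagonal N => g c
  rwa [Finset.univ_eq_attach, Finset.sum_attach] at this

theorem ConvergesBelow.hasFPowerSeriesOnBall (hR : 0 < R) (h : ConvergesBelow R a) :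
    HasFPowerSeriesOnBall (doubleSeries a) (doubleFormalSeries a) 0 (ENNReal.ofReal R) := by
  refine ⟨?_, by simpa using hR, fun {q} hq => ?_⟩
  · refine ENNReal.le_of_forall_pos_nnreal_lt fun ρ h0 h1 => ?_
    have h1' : (ρ : ℝ) < R := by
      rwa [← ENNReal.ofReal_coe_nnreal, ENNReal.ofReal_lt_ofReal_iff hR] at h1
    refine FormalMultilinearSeries.le_radius_of_summable _ ?_
    refine Summable.of_nonneg_of_le (fun N => by positivity) (fun N => ?_)
      (hasSum_antidiagonal (h ρ (by exact_mod_cast h0) h1').hasSum).summable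
    calc ‖doubleFormalSeries a N‖ * (ρ : ℝ) ^ N
        ≤ (∑ k ∈ antidiagonal N, ‖a k‖) * (ρ : ℝ) ^ N := by
          gcongr; exact norm_doubleFormalSeries_le a N
      _ = _ := by
        rw [Finset.sum_mul]
        refine Finset.sum_congr rfl fun k hk => ?_
        rw [Finset.HasAntidiagonal.mem_antidiagonal.1 hk]
  · have hq' : ‖q‖ < R := by
      simpa [Metric.mem_eball] using hq
    have := hasSum_antidiagonal (h.summable ((norm_fst_le q).trans_lt hq')
      ((norm_snd_le q).trans_lt hq')).hasSum
    simpa only [doubleFormalSeries_apply, zero_add, doubleSeries] using this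

theorem ConvergesBelow.analyticAt (h : ConvergesBelow R a) {p : ℂ × ℂ} (hx : ‖p.1‖ < R)
    (hy : ‖p.2‖ < R) : AnalyticAt ℂ (doubleSeries a) p := by
  have hR : 0 < R := (norm_nonneg _).trans_lt hx
  refine (h.hasFPowerSeriesOnBall hR).analyticAt_of_mem ?_
  rw [Metric.mem_eball, edist_zero_right, ← ofReal_norm, ENNReal.ofReal_lt_ofReal_iff hR,
    Prod.norm_def]
  exact max_lt hx hy

theorem hasDerivAt_doubleSeries_fst (h : ConvergesBelow R a) {p : ℂ × ℂ} (hx : ‖p.1‖ < R)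
    (hy : ‖p.2‖ < R) :
    HasDerivAt (fun t => doubleSeries a (t, p.2))
      (∑' k : ℕ × ℕ, a k * (k.1 * p.1 ^ (k.1 - 1)) * p.2 ^ k.2) p.1 := by
  obtain ⟨ρ, h1, h2⟩ := exists_between (max_lt hx hy)
  have hxρ := (le_max_left _ _).trans_lt h1
  have hyρ := (le_max_right _ _).trans_lt h1
  have hρ : 0 < ρ := (norm_nonneg _).trans_lt hxρ
  have hbound := ((h.weight 1 0 0) ρ hρ h2).mul_right ρ⁻¹
  refine hasDerivAt_tsum_of_isPreconnected (t := Metric.ball 0 ρ)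
    (g := fun (k : ℕ × ℕ) t => a k * t ^ k.1 * p.2 ^ k.2)
    (g' := fun k t => a k * (k.1 * t ^ (k.1 - 1)) * p.2 ^ k.2) hbound Metric.isOpen_ball
    (convex_ball _ _).isPreconnected (fun k t _ => ?_) (fun k t ht => ?_)
    (y₀ := p.1) (by simpa using hxρ) (h.summable hx hy) (by simpa using hxρ)
  · exact ((hasDerivAt_pow k.1 t).const_mul (a k)).mul_const _
  · have htρ : ‖t‖ ≤ ρ := by simpa using (Metric.mem_ball.1 ht).le
    obtain ⟨_ | m, n⟩ := k
    · simp
    · simp only [norm_mul, norm_pow, one_mul, zero_mul, add_zero, Nat.add_sub_cancel,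
        Complex.norm_natCast]
      calc ‖a (m + 1, n)‖ * (((m + 1 : ℕ) : ℝ) * ‖t‖ ^ m) * ‖p.2‖ ^ n
          ≤ ‖a (m + 1, n)‖ * (((m + 1 : ℕ) : ℝ) * ρ ^ m) * ρ ^ n := by gcongr
        _ = _ := by
          field_simp
          ring

theorem thetaX_doubleSeries (h : ConvergesBelow R a) {p : ℂ × ℂ} (hx : ‖p.1‖ < R)
    (hy : ‖p.2‖ < R) : thetaX (doubleSeries a) p = doubleSeries (fun k => k.1 * a k) p := by
  rw [thetaX, (hasDerivAt_doubleSeries_fst h hx hy).deriv, ← tsum_mul_left, doubleSeries]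
  refine tsum_congr fun k => ?_
  obtain ⟨_ | m, n⟩ := k
  · simp
  · simp only [Nat.add_sub_cancel]
    ring

theorem doubleSeries_swap (a : ℕ × ℕ → ℂ) (p : ℂ × ℂ) :
    doubleSeries a p = doubleSeries (fun k => a k.swap) p.swap := by
  rw [doubleSeries, doubleSeries, ← (Equiv.prodComm ℕ ℕ).tsum_eq]
  refine tsum_congr fun k => ?_
  simp only [Equiv.prodComm_apply, Prod.fst_swap, Prod.snd_swap]
  ring

theorem ConvergesBelow.swap (h : ConvergesBelow R a) : ConvergesBelow R fun k => a k.swap := by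
  intro ρ h0 h1
  refine ((Equiv.prodComm ℕ ℕ).summable_iff.2 (h ρ h0 h1)).congr fun k => ?_
  simp [add_comm]

theorem thetaY_doubleSeries (h : ConvergesBelow R a) {p : ℂ × ℂ} (hx : ‖p.1‖ < R)
    (hy : ‖p.2‖ < R) : thetaY (doubleSeries a) p = doubleSeries (fun k => k.2 * a k) p := by
  have hswap : (fun t => doubleSeries a (p.1, t))
      = fun t => doubleSeries (fun k => a k.swap) (t, p.1) :=
    funext fun t => doubleSeries_swap a (p.1, t)
  rw [doubleSeries_swap (fun k => k.2 * a k) p, thetaY, hswap]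
  exact thetaX_doubleSeries h.swap (p := p.swap) hy hx

theorem thetaLin_doubleSeries (α β γ : ℂ) (h : ConvergesBelow R a) {p : ℂ × ℂ} (hx : ‖p.1‖ < R)
    (hy : ‖p.2‖ < R) :
    thetaLin α β γ (doubleSeries a) p
      = doubleSeries (fun k => (α * k.1 + β * k.2 + γ) * a k) p := by
  have hX : Summable fun k : ℕ × ℕ => (k.1 * a k) * p.1 ^ k.1 * p.2 ^ k.2 := by
    simpa using (h.weight 1 0 0).summable hx hy
  have hY : Summable fun k : ℕ × ℕ => (k.2 * a k) * p.1 ^ k.1 * p.2 ^ k.2 := by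
    simpa using (h.weight 0 1 0).summable hx hy
  rw [thetaLin, thetaX_doubleSeries h hx hy, thetaY_doubleSeries h hx hy]
  simp only [doubleSeries]
  rw [← tsum_mul_left, ← tsum_mul_left, ← tsum_mul_left,
    ← (hX.mul_left α).tsum_add (hY.mul_left β),
    ← ((hX.mul_left α).add (hY.mul_left β)).tsum_add ((h.summable hx hy).mul_left γ)]
  exact tsum_congr fun k => by ring

theorem doubleSeries_eq_fst_mul {b d : ℕ × ℕ → ℂ} (h0 : ∀ n, b (0, n) = 0)
    (h1 : ∀ m n, b (m + 1, n) = d (m, n)) (p : ℂ × ℂ) :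
    doubleSeries b p = p.1 * doubleSeries d p := by
  have hinj : Function.Injective fun k : ℕ × ℕ => (k.1 + 1, k.2) := by
    rintro ⟨m, n⟩ ⟨m', n'⟩ h; simpa using h
  rw [doubleSeries, ← hinj.tsum_eq, doubleSeries, ← tsum_mul_left]
  · refine tsum_congr fun k => ?_
    rw [h1]; ring
  · rintro ⟨m, n⟩ hk
    rcases m with _ | m
    · simp [h0] at hk
    · exact ⟨(m, n), rfl⟩

theorem doubleSeries_eq_snd_mul {b d : ℕ × ℕ → ℂ} (h0 : ∀ m, b (m, 0) = 0)
    (h1 : ∀ m n, b (m, n + 1) = d (m, n)) (p : ℂ × ℂ) :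
    doubleSeries b p = p.2 * doubleSeries d p := by
  rw [doubleSeries_swap b, doubleSeries_swap d,
    doubleSeries_eq_fst_mul (d := fun k => d k.swap) (fun n => h0 n) (fun m n => h1 n m)]
  rfl

end DoubleSeries

section Frobenius

theorem isOpen_domY (ε : ℝ) : IsOpen (domY ε) :=
  (isOpen_lt continuous_fst.norm continuous_const).inter
    ((isOpen_lt continuous_snd.norm continuous_const).inter
      (Complex.isOpen_slitPlane.preimage continuous_snd))

theorem isOpen_domXY (ε : ℝ) : IsOpen (domXY ε) :=
  (isOpen_domY ε).inter (Complex.isOpen_slitPlane.preimage continuous_fst)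

variable {R : ℝ} {a : ℕ × ℕ → ℂ} {p : ℂ × ℂ} (α β γ ρ σ : ℂ)

/-- The Frobenius series `x ^ ρ y ^ σ ∑ a_{m,n} x ^ m y ^ n`, with principal powers. -/
noncomputable def frobenius (ρ σ : ℂ) (a : ℕ × ℕ → ℂ) (p : ℂ × ℂ) : ℂ :=
  p.1 ^ ρ * p.2 ^ σ * doubleSeries a p

theorem thetaLin_cpow_mul_cpow (hx : p.1 ∈ Complex.slitPlane) (hy : p.2 ∈ Complex.slitPlane) :
    thetaLin α β 0 (fun q => q.1 ^ ρ * q.2 ^ σ) p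
      = (α * ρ + β * σ) * (p.1 ^ ρ * p.2 ^ σ) := by
  have hdx := ((hasDerivAt_id p.1).cpow_const (c := ρ) hx).mul_const (p.2 ^ σ)
  have hdy := ((hasDerivAt_id p.2).cpow_const (c := σ) hy).const_mul (p.1 ^ ρ)
  simp only [id_eq] at hdx hdy
  rw [thetaLin, thetaX, thetaY, hdx.deriv, hdy.deriv,
    Complex.cpow_sub _ _ (Complex.slitPlane_ne_zero hx),
    Complex.cpow_sub _ _ (Complex.slitPlane_ne_zero hy), Complex.cpow_one, Complex.cpow_one]
  field_simp [Complex.slitPlane_ne_zero hx, Complex.slitPlane_ne_zero hy]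
  ring

theorem analyticAt_cpow_mul_cpow (hx : p.1 ∈ Complex.slitPlane) (hy : p.2 ∈ Complex.slitPlane) :
    AnalyticAt ℂ (fun q : ℂ × ℂ => q.1 ^ ρ * q.2 ^ σ) p :=
  (analyticAt_fst.cpow analyticAt_const hx).mul (analyticAt_snd.cpow analyticAt_const hy)

theorem analyticAt_frobenius (h : ConvergesBelow R a) (hp : p ∈ domXY R) :
    AnalyticAt ℂ (frobenius ρ σ a) p :=
  (analyticAt_cpow_mul_cpow ρ σ hp.2 hp.1.2.2).mul (h.analyticAt hp.1.1 hp.1.2.1)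

theorem ConvergesBelow.weight_shift (h : ConvergesBelow R a) :
    ConvergesBelow R fun k => (α * (k.1 + ρ) + β * (k.2 + σ) + γ) * a k := by
  convert h.weight α β (α * ρ + β * σ + γ) using 3
  ring

theorem thetaLin_frobenius (h : ConvergesBelow R a) (hp : p ∈ domXY R) :
    thetaLin α β γ (frobenius ρ σ a) p
      = frobenius ρ σ (fun k => (α * (k.1 + ρ) + β * (k.2 + σ) + γ) * a k) p := by
  obtain ⟨⟨hx, hy, hys⟩, hxs⟩ := hp
  have hswap : frobenius ρ σ a = fun q => doubleSeries a q * (q.1 ^ ρ * q.2 ^ σ) :=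
    funext fun q => mul_comm _ _
  have hweight : (fun k : ℕ × ℕ => (α * (k.1 + ρ) + β * (k.2 + σ) + γ) * a k)
      = fun k => (α * k.1 + β * k.2 + (α * ρ + β * σ + γ)) * a k := by
    funext k; ring
  rw [hswap, thetaLin_mul _ _ _ (h.analyticAt hx hy).differentiableAt
      (analyticAt_cpow_mul_cpow ρ σ hxs hys).differentiableAt,
    thetaLin_cpow_mul_cpow _ _ _ _ hxs hys, frobenius, hweight,
    ← thetaLin_doubleSeries _ _ _ h hx hy, thetaLin, thetaLin]
  ring

theorem thetaLin_thetaLin_frobenius (α' β' γ' : ℂ) (h : ConvergesBelow R a)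
    (hp : p ∈ domXY R) :
    thetaLin α β γ (thetaLin α' β' γ' (frobenius ρ σ a)) p
      = frobenius ρ σ (fun k => (α * (k.1 + ρ) + β * (k.2 + σ) + γ)
          * ((α' * (k.1 + ρ) + β' * (k.2 + σ) + γ') * a k)) p := by
  have he : thetaLin α' β' γ' (frobenius ρ σ a) =ᶠ[𝓝 p]
      frobenius ρ σ (fun k => (α' * (k.1 + ρ) + β' * (k.2 + σ) + γ') * a k) :=
    eventually_of_mem ((isOpen_domXY R).mem_nhds hp) fun q hq =>
      thetaLin_frobenius α' β' γ' ρ σ h hq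
  rw [thetaLin_congr _ _ _ he, thetaLin_frobenius _ _ _ _ _ (h.weight_shift α' β' γ' ρ σ) hp]

theorem isHornSolution_frobenius {A B c : ℂ} (h : ConvergesBelow R a)
    (hx0 : ∀ n : ℕ, ρ * (-ρ + (n + σ) + B) * a (0, n) = 0)
    (hx1 : ∀ m n : ℕ, (m + 1 + ρ) * (-(m + 1 + ρ) + (n + σ) + B) * a (m + 1, n)
      = (2 * (m + ρ) + (n + σ) + A) * (2 * (m + ρ) + (n + σ) + A + 1) * a (m, n))
    (hy0 : ∀ m : ℕ, σ * (σ + c - 1) * a (m, 0) = 0)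
    (hy1 : ∀ m n : ℕ, (n + 1 + σ) * (n + 1 + σ + c - 1) * a (m, n + 1)
      = (2 * (m + ρ) + (n + σ) + A) * (-(m + ρ) + (n + σ) + B) * a (m, n)) :
    IsHornSolution A B c (domXY R) (frobenius ρ σ a) := by
  refine ⟨fun p hp => analyticAt_frobenius ρ σ h hp, fun p hp => ?_, fun p hp => ?_⟩
  · rw [thetaX_eq_thetaLin, thetaLin_thetaLin_frobenius _ _ _ _ _ _ _ _ h hp,
      thetaLin_thetaLin_frobenius _ _ _ _ _ _ _ _ h hp, frobenius, frobenius,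
      doubleSeries_eq_fst_mul (d := fun k : ℕ × ℕ => (2 * (k.1 + ρ) + 1 * (k.2 + σ) + A)
          * ((2 * (k.1 + ρ) + 1 * (k.2 + σ) + (A + 1)) * a k))]
    · ring
    · intro n
      push_cast
      linear_combination hx0 n
    · intro m n
      push_cast
      linear_combination hx1 m n
  · rw [thetaY_eq_thetaLin, thetaLin_thetaLin_frobenius _ _ _ _ _ _ _ _ h hp,
      thetaLin_thetaLin_frobenius _ _ _ _ _ _ _ _ h hp, frobenius, frobenius,
      doubleSeries_eq_snd_mul (d := fun k : ℕ × ℕ => (2 * (k.1 + ρ) + 1 * (k.2 + σ) + A)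
          * ((-1 * (k.1 + ρ) + 1 * (k.2 + σ) + B) * a k))]
    · ring
    · intro m
      push_cast
      linear_combination hy0 m
    · intro m n
      push_cast
      linear_combination hy1 m n

end Frobenius

section Pochhammer

theorem poch_zero (b : ℂ) : poch b 0 = 1 := by simp [poch]

theorem poch_succ (b : ℂ) (n : ℕ) : poch b (n + 1) = poch b n * (b + n) := by
  simp [poch, ascPochhammer_succ_eval]

theorem poch_succ_left (b : ℂ) (n : ℕ) : poch b (n + 1) = b * poch (b + 1) n := by
  simp [poch, ascPochhammer_succ_left, Polynomial.eval_comp]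

theorem poch_ne_zero {b : ℂ} (hb : ∀ j : ℕ, b + j ≠ 0) (n : ℕ) : poch b n ≠ 0 := by
  induction n with
  | zero => simp [poch_zero]
  | succ n ih => rw [poch_succ]; exact mul_ne_zero ih (hb n)

theorem norm_poch_le_descFactorial {b : ℂ} {M : ℕ} (hM : ‖b‖ ≤ M) (n : ℕ) :
    ‖poch b n‖ ≤ (M + n).descFactorial n := by
  induction n with
  | zero => simp [poch_zero]
  | succ n ih =>
    rw [poch_succ, norm_mul, ← add_assoc, Nat.succ_descFactorial_succ, mul_comm]
    push_cast
    refine mul_le_mul ?_ ih (norm_nonneg _) (by positivity)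
    refine (norm_add_le _ _).trans ?_
    rw [Complex.norm_natCast]
    linarith

theorem exists_norm_poch_le (b : ℂ) :
    ∃ C : ℝ, 0 < C ∧ ∀ n : ℕ, ‖poch b n‖ ≤ C * 2 ^ n * n.factorial := by
  obtain ⟨M, hM⟩ := exists_nat_ge ‖b‖
  refine ⟨2 ^ M, by positivity, fun n => (norm_poch_le_descFactorial hM n).trans ?_⟩
  rw [Nat.descFactorial_eq_factorial_mul_choose, mul_comm, ← pow_add]
  push_cast
  gcongr
  exact_mod_cast Nat.choose_le_two_pow (M + n) n

theorem exists_factorial_le_norm_poch {b : ℂ} (hb : ∀ j : ℕ, b + j ≠ 0) :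
    ∃ C : ℝ, 0 < C ∧ ∀ n : ℕ, (n.factorial : ℝ) ≤ C * 2 ^ n * ‖poch b n‖ := by
  set u : ℕ → ℂ := fun n => n.factorial / (2 ^ n * poch b n) with hu
  have hratio : ∀ᶠ n in atTop, ‖u (n + 1)‖ ≤ 3 / 4 * ‖u n‖ := by
    filter_upwards [eventually_ge_atTop ⌈3 * ‖b‖ + 2⌉₊] with n hn
    have hstep : u (n + 1) = (n + 1 : ℕ) / (2 * (b + n)) * u n := by
      simp only [hu, Nat.factorial_succ, poch_succ, pow_succ]
      field_simp [poch_ne_zero hb n, hb n]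
      push_cast
      ring
    have htri : (n : ℝ) - ‖b‖ ≤ ‖b + n‖ := by
      simpa [add_comm] using norm_sub_norm_le (n : ℂ) (-b)
    have hn' : 3 * ‖b‖ + 2 ≤ n := Nat.ceil_le.1 hn
    rw [hstep, norm_mul, norm_div, norm_mul, Complex.norm_natCast, Complex.norm_two]
    refine mul_le_mul_of_nonneg_right ?_ (norm_nonneg _)
    rw [div_le_iff₀ (by linarith [norm_nonneg b])]
    push_cast
    linarith
  obtain ⟨C, hC⟩ := (summable_of_ratio_norm_eventually_le (by norm_num)
    hratio).tendsto_atTop_zero.norm.bddAbove_range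
  have hC' : ∀ n, ‖u n‖ ≤ C := fun n => hC ⟨n, rfl⟩
  refine ⟨C, zero_lt_one.trans_le (by simpa [hu, poch_zero] using hC' 0), fun n => ?_⟩
  have hpos : 0 < ‖poch b n‖ := norm_pos_iff.2 (poch_ne_zero hb n)
  have hn := hC' n
  rwa [hu, norm_div, norm_mul, Complex.norm_natCast, norm_pow, Complex.norm_two,
    div_le_iff₀ (by positivity), ← mul_assoc] at hn

theorem poch_sub_self (b : ℂ) (n : ℕ) : poch (b - n) n = (-1) ^ n * poch (1 - b) n := by
  induction n with
  | zero => simp [poch_zero]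
  | succ n ih =>
    rw [poch_succ_left, poch_succ]
    push_cast
    rw [show b - (n + 1) + 1 = b - (n : ℂ) by ring, ih]
    ring

theorem norm_poch_sub_self (b : ℂ) (n : ℕ) : ‖poch (b - n) n‖ = ‖poch (1 - b) n‖ := by
  simp [poch_sub_self]

theorem pochInt_natCast (b : ℂ) (n : ℕ) : pochInt b n = poch b n := rfl

theorem pochInt_neg_natCast (b : ℂ) (n : ℕ) : pochInt b (-n) = (poch (b - n) n)⁻¹ := by
  rcases n with _ | n
  · simp [pochInt, poch_zero]
  · rw [show (-((n + 1 : ℕ) : ℤ)) = Int.negSucc n from rfl, pochInt]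
    push_cast
    rfl

theorem pochInt_add_one {b : ℂ} (hb : ∀ k : ℤ, b ≠ k) (k : ℤ) :
    pochInt b (k + 1) = pochInt b k * (b + k) := by
  rcases le_or_gt 0 k with hk | hk
  · lift k to ℕ using hk
    exact_mod_cast poch_succ b k
  · obtain ⟨n, rfl⟩ : ∃ n : ℕ, k = -((n + 1 : ℕ) : ℤ) := ⟨(-k - 1).toNat, by push_cast; omega⟩
    have h0 : b - (n + 1) ≠ 0 := by
      simpa [sub_eq_zero] using hb (n + 1 : ℤ)
    rw [show (-((n + 1 : ℕ) : ℤ)) + 1 = -(n : ℤ) by push_cast; ring, pochInt_neg_natCast,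
      pochInt_neg_natCast, poch_succ_left, mul_inv]
    push_cast
    rw [show b - (n + 1) + 1 = b - (n : ℂ) by ring, ← sub_eq_add_neg, mul_right_comm,
      inv_mul_cancel₀ h0, one_mul]

theorem add_natCast_ne_zero {b : ℂ} (hb : ∀ k : ℤ, b ≠ k) (j : ℕ) : b + j ≠ 0 := fun h =>
  hb (-j) (by push_cast; linear_combination h)

theorem exists_norm_pochInt_natCast_le (b : ℂ) :
    ∃ C : ℝ, 0 < C ∧ ∀ m k : ℕ, ‖pochInt b k‖ * m.factorial
      ≤ C * 4 ^ (m + k) * (m + k).factorial := by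
  obtain ⟨C, hC, h⟩ := exists_norm_poch_le b
  refine ⟨C, hC, fun m k => ?_⟩
  have hfac : (m.factorial : ℝ) * k.factorial ≤ (m + k).factorial := by
    exact_mod_cast Nat.le_of_dvd (Nat.factorial_pos _)
      (Nat.factorial_mul_factorial_dvd_factorial_add m k)
  have hpow : (2 : ℝ) ^ k ≤ 4 ^ (m + k) :=
    (pow_le_pow_left₀ (by norm_num) (by norm_num) k).trans
      (pow_le_pow_right₀ (by norm_num) (Nat.le_add_left k m))
  rw [pochInt_natCast]
  calc ‖poch b k‖ * m.factorial ≤ C * 2 ^ k * k.factorial * m.factorial := by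
        gcongr; exact h k
    _ = C * 2 ^ k * (m.factorial * k.factorial) := by ring
    _ ≤ C * 4 ^ (m + k) * (m + k).factorial := by gcongr

theorem exists_norm_pochInt_neg_natCast_le {b : ℂ} (hb : ∀ k : ℤ, b ≠ k) :
    ∃ C : ℝ, 0 < C ∧ ∀ n k : ℕ, ‖pochInt b (-k)‖ * (n + k).factorial
      ≤ C * 4 ^ (n + k) * n.factorial := by
  have hb' : ∀ j : ℕ, (1 - b) + j ≠ 0 := fun j h =>
    hb (j + 1) (by push_cast; linear_combination -h)
  obtain ⟨C, hC, h⟩ := exists_factorial_le_norm_poch hb'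
  refine ⟨C, hC, fun n k => ?_⟩
  have hpos : 0 < ‖poch (1 - b) k‖ := norm_pos_iff.2 (poch_ne_zero hb' k)
  have hchoose : ((n + k).choose k : ℝ) ≤ 2 ^ (n + k) := by
    exact_mod_cast Nat.choose_le_two_pow _ _
  have hpow : (2 : ℝ) ^ (n + k) * 2 ^ k ≤ 4 ^ (n + k) := by
    rw [show (4 : ℝ) = 2 * 2 by norm_num, mul_pow]
    gcongr
    · norm_num
    · exact Nat.le_add_left k n
  rw [pochInt_neg_natCast, norm_inv, norm_poch_sub_self, inv_mul_le_iff₀ hpos,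
    ← Nat.add_choose_mul_factorial_mul_factorial n k]
  push_cast
  calc ((n + k).choose k : ℝ) * n.factorial * k.factorial
      ≤ 2 ^ (n + k) * n.factorial * (C * 2 ^ k * ‖poch (1 - b) k‖) := by
        gcongr; exact h k
    _ = ‖poch (1 - b) k‖ * (C * (2 ^ (n + k) * 2 ^ k) * n.factorial) := by ring
    _ ≤ ‖poch (1 - b) k‖ * (C * 4 ^ (n + k) * n.factorial) := by gcongr

theorem exists_norm_pochInt_sub_le {b : ℂ} (hb : ∀ k : ℤ, b ≠ k) :
    ∃ C : ℝ, 0 < C ∧ ∀ m n : ℕ, ‖pochInt b ((n : ℤ) - m)‖ * m.factorial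
      ≤ C * 4 ^ (m + n) * n.factorial := by
  obtain ⟨C₁, hC₁, h₁⟩ := exists_norm_pochInt_natCast_le b
  obtain ⟨C₂, hC₂, h₂⟩ := exists_norm_pochInt_neg_natCast_le hb
  refine ⟨C₁ + C₂, by positivity, fun m n => ?_⟩
  rcases le_total m n with h | h
  · obtain ⟨k, rfl⟩ := Nat.exists_eq_add_of_le h
    rw [show ((m + k : ℕ) : ℤ) - m = k by push_cast; ring]
    refine (h₁ m k).trans ?_
    gcongr
    · linarith
    · norm_num
    · omega
  · obtain ⟨k, rfl⟩ := Nat.exists_eq_add_of_le h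
    rw [show (n : ℤ) - ((n + k : ℕ) : ℤ) = -k by push_cast; ring]
    refine (h₂ n k).trans (mul_le_mul_of_nonneg_right ?_ (by positivity))
    exact mul_le_mul (by linarith) (pow_le_pow_right₀ (by norm_num) (Nat.le_add_right _ _))
      (by positivity) (by positivity)

theorem factorial_le_two_pow_mul {m n : ℕ} (h : n ≤ m) :
    m.factorial ≤ 2 ^ m * (n.factorial * (m - n).factorial) := by
  rw [← Nat.choose_mul_factorial_mul_factorial h, mul_assoc]
  exact Nat.mul_le_mul_right _ (Nat.choose_le_two_pow m n)

theorem factorial_two_mul_add_le (m n : ℕ) :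
    (2 * m + n).factorial ≤ 16 ^ m * 2 ^ n * (m.factorial * m.factorial * n.factorial) := by
  have hm : (2 * m).factorial = (2 * m).choose m * m.factorial * m.factorial := by
    rw [two_mul, Nat.add_choose_mul_factorial_mul_factorial]
  calc (2 * m + n).factorial
      = (2 * m + n).choose n * ((2 * m).choose m * m.factorial * m.factorial)
          * n.factorial := by
        rw [← hm, Nat.add_choose_mul_factorial_mul_factorial]
    _ ≤ 2 ^ (2 * m + n) * (2 ^ (2 * m) * m.factorial * m.factorial) * n.factorial := by
        gcongr <;> exact Nat.choose_le_two_pow _ _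
    _ = 16 ^ m * 2 ^ n * (m.factorial * m.factorial * n.factorial) := by
        rw [pow_add, pow_mul, show 16 = 2 ^ 2 * 2 ^ 2 by norm_num, mul_pow]
        ring

end Pochhammer

section Coefficients

variable (a e : ℂ) {b c d : ℂ}

/-- The coefficients of Horn's series `H₅(a, b, c | x, y)`. -/
noncomputable def h5Coeff (a b c : ℂ) (k : ℕ × ℕ) : ℂ :=
  poch a (2 * k.1 + k.2) * pochInt b ((k.2 : ℤ) - (k.1 : ℤ))
    / (poch c k.2 * (k.1.factorial : ℂ) * (k.2.factorial : ℂ))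

/-- The coefficients, in powers of `x` and `y`, of
`∑ (e)_{2m+3n} / ((c)_n (d)_{m+n} m! n!) (-x) ^ m (x y) ^ n`; the exponents `(m + n, n)` fill
the cone `k.2 ≤ k.1`. -/
noncomputable def coneCoeff (e d c : ℂ) (k : ℕ × ℕ) : ℂ :=
  if k.2 ≤ k.1 then
    (-1) ^ (k.1 - k.2) * poch e (2 * k.1 + k.2)
      / (poch c k.2 * poch d k.1 * ((k.1 - k.2).factorial : ℂ) * (k.2.factorial : ℂ))
  else 0

theorem convergesBelow_h5Coeff (hb : ∀ k : ℤ, b ≠ k) (hc : ∀ j : ℕ, c + j ≠ 0) :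
    ConvergesBelow 256⁻¹ (h5Coeff a b c) := by
  obtain ⟨C₁, hC₁, h₁⟩ := exists_norm_poch_le a
  obtain ⟨C₂, hC₂, h₂⟩ := exists_norm_pochInt_sub_le hb
  obtain ⟨C₃, hC₃, h₃⟩ := exists_factorial_le_norm_poch hc
  refine convergesBelow_of_norm_le (C := C₁ * C₂ * C₃) (by norm_num) fun ⟨m, n⟩ => ?_
  have hpos : 0 < ‖poch c n‖ := norm_pos_iff.2 (poch_ne_zero hc n)
  have hfac : ((2 * m + n).factorial : ℝ)
      ≤ 16 ^ m * 2 ^ n * (m.factorial * m.factorial * n.factorial) := by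
    exact_mod_cast factorial_two_mul_add_le m n
  simp only [h5Coeff, norm_div, norm_mul, Complex.norm_natCast]
  rw [div_le_iff₀ (by positivity)]
  have hmn : (0 : ℝ) < m.factorial * n.factorial := by positivity
  refine le_of_mul_le_mul_right ?_ hmn
  calc ‖poch a (2 * m + n)‖ * ‖pochInt b ((n : ℤ) - m)‖ * (m.factorial * n.factorial)
      = ‖poch a (2 * m + n)‖ * (‖pochInt b ((n : ℤ) - m)‖ * m.factorial) * n.factorial := by ring
    _ ≤ (C₁ * 2 ^ (2 * m + n)
          * (16 ^ m * 2 ^ n * (m.factorial * m.factorial * n.factorial)))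
        * (C₂ * 4 ^ (m + n) * n.factorial) * (C₃ * 2 ^ n * ‖poch c n‖) :=
        mul_le_mul (mul_le_mul ((h₁ _).trans (by gcongr)) (h₂ m n) (by positivity)
          (by positivity)) (h₃ n) (by positivity) (by positivity)
    _ = C₁ * C₂ * C₃ * (256 ^ m * 32 ^ n)
        * (‖poch c n‖ * m.factorial * n.factorial) * (m.factorial * n.factorial) := by
        rw [pow_add, pow_add, pow_mul, show (256 : ℝ) = 2 ^ 2 * 16 * 4 by norm_num,
          show (32 : ℝ) = 2 * 2 * 4 * 2 by norm_num]
        simp only [mul_pow]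
        ring
    _ ≤ C₁ * C₂ * C₃ * 256 ^ (m + n)
        * (‖poch c n‖ * m.factorial * n.factorial) * (m.factorial * n.factorial) := by
        rw [pow_add]
        gcongr
        norm_num

theorem convergesBelow_coneCoeff (hd : ∀ j : ℕ, d + j ≠ 0) (hc : ∀ j : ℕ, c + j ≠ 0) :
    ConvergesBelow 256⁻¹ (coneCoeff e d c) := by
  obtain ⟨C₁, hC₁, h₁⟩ := exists_norm_poch_le e
  obtain ⟨C₂, hC₂, h₂⟩ := exists_factorial_le_norm_poch hd
  obtain ⟨C₃, hC₃, h₃⟩ := exists_factorial_le_norm_poch hc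
  refine convergesBelow_of_norm_le (C := C₁ * C₂ * C₃) (by norm_num) fun ⟨m, n⟩ => ?_
  rcases lt_or_ge m n with h | h
  · rw [coneCoeff, if_neg (by simpa using h), norm_zero]
    positivity
  have hposc : 0 < ‖poch c n‖ := norm_pos_iff.2 (poch_ne_zero hc n)
  have hposd : 0 < ‖poch d m‖ := norm_pos_iff.2 (poch_ne_zero hd m)
  have hfac : ((2 * m + n).factorial : ℝ)
      ≤ 16 ^ m * 2 ^ n * (m.factorial * m.factorial * n.factorial) := by
    exact_mod_cast factorial_two_mul_add_le m n
  have hsub : (m.factorial : ℝ) ≤ 2 ^ m * (n.factorial * (m - n).factorial) := by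
    exact_mod_cast factorial_le_two_pow_mul h
  simp only [coneCoeff, if_pos h, norm_div, norm_mul, Complex.norm_natCast, norm_pow, norm_neg,
    norm_one, one_pow, one_mul]
  rw [div_le_iff₀ (by positivity)]
  calc ‖poch e (2 * m + n)‖
      ≤ C₁ * 2 ^ (2 * m + n) * (16 ^ m * 2 ^ n * (m.factorial * m.factorial * n.factorial)) :=
        (h₁ _).trans (by gcongr)
    _ ≤ C₁ * 2 ^ (2 * m + n) * (16 ^ m * 2 ^ n * ((2 ^ m * (n.factorial * (m - n).factorial))
            * (C₂ * 2 ^ m * ‖poch d m‖) * (C₃ * 2 ^ n * ‖poch c n‖))) := by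
        gcongr
        · exact h₂ m
        · exact h₃ n
    _ = C₁ * C₂ * C₃ * (256 ^ m * 8 ^ n)
        * (‖poch c n‖ * ‖poch d m‖ * (m - n).factorial * n.factorial) := by
        rw [pow_add, pow_mul, show (256 : ℝ) = 2 ^ 2 * 16 * 2 * 2 by norm_num,
          show (8 : ℝ) = 2 * 2 * 2 by norm_num]
        simp only [mul_pow]
        ring
    _ ≤ C₁ * C₂ * C₃ * 256 ^ (m + n)
        * (‖poch c n‖ * ‖poch d m‖ * (m - n).factorial * n.factorial) := by
        rw [pow_add]
        gcongr
        norm_num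

theorem h5Coeff_succ_fst (c : ℂ) (hb : ∀ k : ℤ, b ≠ k) (m n : ℕ) :
    (m + 1) * (b + n - (m + 1)) * h5Coeff a b c (m + 1, n)
      = (a + 2 * m + n) * (a + 2 * m + n + 1) * h5Coeff a b c (m, n) := by
  have hp : pochInt b ((n : ℤ) - m)
      = pochInt b ((n : ℤ) - (m + 1 : ℕ)) * (b + (n - (m + 1))) := by
    have := pochInt_add_one hb ((n : ℤ) - (m + 1 : ℕ))
    rw [show (n : ℤ) - (m + 1 : ℕ) + 1 = n - m by push_cast; ring] at this
    rw [this]; push_cast; ring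
  have hm1 : (m : ℂ) + 1 ≠ 0 := by exact_mod_cast m.succ_ne_zero
  simp only [h5Coeff]
  rw [show 2 * (m + 1) + n = 2 * m + n + 1 + 1 by ring, poch_succ, poch_succ, hp,
    Nat.factorial_succ]
  push_cast
  rcases eq_or_ne (poch c n) 0 with h | h
  · simp [h]
  · field_simp
    ring

theorem h5Coeff_succ_snd (hb : ∀ k : ℤ, b ≠ k) (m : ℕ) {n : ℕ} (hc : c + n ≠ 0) :
    (c + n) * (n + 1) * h5Coeff a b c (m, n + 1)
      = (a + 2 * m + n) * (b + n - m) * h5Coeff a b c (m, n) := by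
  have hp : pochInt b (((n + 1 : ℕ) : ℤ) - m) = pochInt b ((n : ℤ) - m) * (b + (n - m)) := by
    have := pochInt_add_one hb ((n : ℤ) - m)
    rw [show (n : ℤ) - m + 1 = (n + 1 : ℕ) - m by push_cast; ring] at this
    rw [this]; push_cast; ring
  have hn1 : (n : ℂ) + 1 ≠ 0 := by exact_mod_cast n.succ_ne_zero
  simp only [h5Coeff]
  rw [show 2 * m + (n + 1) = 2 * m + n + 1 by ring, poch_succ, poch_succ, hp,
    Nat.factorial_succ]
  push_cast
  rcases eq_or_ne (poch c n) 0 with h | h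
  · simp [h]
  · field_simp
    ring

theorem coneCoeff_of_lt (d c : ℂ) {m n : ℕ} (h : m < n) : coneCoeff e d c (m, n) = 0 :=
  if_neg (not_le.2 h)

theorem coneCoeff_add (d c : ℂ) (j n : ℕ) :
    coneCoeff e d c (j + n, n) = (-1) ^ j * poch e (2 * (j + n) + n)
      / (poch c n * poch d (j + n) * (j.factorial : ℂ) * (n.factorial : ℂ)) := by
  simp [coneCoeff]

theorem coneCoeff_succ_fst (c : ℂ) {m : ℕ} (hd : d + m ≠ 0) (n : ℕ) :
    (d + m) * (m + 1 - n) * coneCoeff e d c (m + 1, n)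
      = -((e + 2 * m + n) * (e + 2 * m + n + 1) * coneCoeff e d c (m, n)) := by
  rcases lt_trichotomy n (m + 1) with h | rfl | h
  · obtain ⟨j, rfl⟩ := Nat.exists_eq_add_of_le' (Nat.lt_succ_iff.1 h)
    have hj1 : (j : ℂ) + 1 ≠ 0 := by exact_mod_cast j.succ_ne_zero
    rw [show j + n + 1 = (j + 1) + n by ring, coneCoeff_add, coneCoeff_add,
      show 2 * ((j + 1) + n) + n = 2 * (j + n) + n + 1 + 1 by ring,
      show (j + 1) + n = j + n + 1 by ring, poch_succ, poch_succ, poch_succ,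
      Nat.factorial_succ, pow_succ]
    push_cast at hd ⊢
    rcases eq_or_ne (poch c n * poch d (j + n)) 0 with h0 | h0
    · rcases mul_eq_zero.1 h0 with h0 | h0 <;> simp [h0]
    · obtain ⟨hcn, hdn⟩ := mul_ne_zero_iff.1 h0
      field_simp
      ring
  · rw [coneCoeff_of_lt _ _ _ (Nat.lt_succ_self m)]
    simp
  · rw [coneCoeff_of_lt _ _ _ h, coneCoeff_of_lt _ _ _ ((Nat.lt_succ_self m).trans h)]
    simp

theorem coneCoeff_succ_snd (d : ℂ) (m : ℕ) {n : ℕ} (hc : c + n ≠ 0) :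
    (c + n) * (n + 1) * coneCoeff e d c (m, n + 1)
      = (e + 2 * m + n) * (n - m) * coneCoeff e d c (m, n) := by
  rcases lt_trichotomy n m with h | rfl | h
  · obtain ⟨j, rfl⟩ := Nat.exists_eq_add_of_le' (Nat.succ_le_of_lt h)
    have hj1 : (j : ℂ) + 1 ≠ 0 := by exact_mod_cast j.succ_ne_zero
    have hn1 : (n : ℂ) + 1 ≠ 0 := by exact_mod_cast n.succ_ne_zero
    rw [Nat.succ_eq_add_one, coneCoeff_add, show j + (n + 1) = (j + 1) + n by ring, coneCoeff_add,
      show 2 * ((j + 1) + n) + (n + 1) = 2 * ((j + 1) + n) + n + 1 by ring,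
      poch_succ e, poch_succ c, Nat.factorial_succ, Nat.factorial_succ, pow_succ]
    push_cast
    rcases eq_or_ne (poch c n * poch d (j + 1 + n)) 0 with h0 | h0
    · rcases mul_eq_zero.1 h0 with h0 | h0 <;> simp [h0]
    · obtain ⟨hcn, hdn⟩ := mul_ne_zero_iff.1 h0
      field_simp
      ring
  · rw [coneCoeff_of_lt _ _ _ (Nat.lt_succ_self n)]
    simp
  · rw [coneCoeff_of_lt _ _ _ h, coneCoeff_of_lt _ _ _ (h.trans (Nat.lt_succ_self n))]
    simp

end Coefficients

section Solutions

variable {A B C a b c d e ρ σ r : ℂ}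

theorem isHornSolution_frobenius_h5Coeff (ha : a = A + σ) (hbB : b = B + σ)
    (hσ : σ * (σ + C - 1) = 0) (hc : c = 2 * σ + C) (hb : ∀ k : ℤ, b ≠ k)
    (hcn : ∀ j : ℕ, c + j ≠ 0) :
    IsHornSolution A B C (domXY 256⁻¹) (frobenius 0 σ (h5Coeff a b c)) := by
  refine isHornSolution_frobenius 0 σ (convergesBelow_h5Coeff a hb hcn) (fun n => by simp)
    (fun m n => ?_) (fun m => by rw [hσ, zero_mul]) (fun m n => ?_)
  · have hrec := h5Coeff_succ_fst a c hb m n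
    subst ha hbB
    linear_combination hrec
  · have hrec := h5Coeff_succ_snd a hb m (hcn n)
    have hweight : (n + 1 + σ) * (n + 1 + σ + C - 1) = (c + n) * (n + 1) := by
      linear_combination hσ - (n + 1) * hc
    rw [hweight, hrec, ha, hbB]
    ring

theorem isHornSolution_frobenius_coneCoeff (he : e = 2 * ρ + σ + A) (hd : d = 1 + ρ)
    (hρ : -ρ + σ + B = 0) (hσ : σ * (σ + C - 1) = 0) (hc : c = 2 * σ + C)
    (hdn : ∀ j : ℕ, d + j ≠ 0) (hcn : ∀ j : ℕ, c + j ≠ 0) :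
    IsHornSolution A B C (domXY 256⁻¹) (frobenius ρ σ (coneCoeff e d c)) := by
  refine isHornSolution_frobenius ρ σ (convergesBelow_coneCoeff e hdn hcn) (fun n => ?_)
    (fun m n => ?_) (fun m => by rw [hσ, zero_mul]) (fun m n => ?_)
  · rcases n with _ | n
    · push_cast
      linear_combination ρ * coneCoeff e d c (0, 0) * hρ
    · rw [coneCoeff_of_lt _ _ _ n.succ_pos, mul_zero]
  · have hrec := coneCoeff_succ_fst e c (hdn m) n
    obtain rfl : B = ρ - σ := by linear_combination hρ
    subst he hd
    linear_combination -hrec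
  · have hrec := coneCoeff_succ_snd e d m (hcn n)
    have hweight : (n + 1 + σ) * (n + 1 + σ + C - 1) = (c + n) * (n + 1) := by
      linear_combination hσ - (n + 1) * hc
    obtain rfl : B = ρ - σ := by linear_combination hρ
    rw [hweight, hrec, he]
    ring

/-- The exponents of `x` in the local solutions `Φ₁, Φ₂, Φ₃, Φ₄`. -/
noncomputable def phiExpX (r : ℂ) : Fin 4 → ℂ := ![0, 0, -r, -r + 1 / 2]

/-- The exponents of `y` in the local solutions `Φ₁, Φ₂, Φ₃, Φ₄`. -/
noncomputable def phiExpY : Fin 4 → ℂ := ![0, 1 / 2, 0, 1 / 2]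

/-- The coefficients of the power series in the local solutions `Φ₁, Φ₂, Φ₃, Φ₄`. -/
noncomputable def phiCoeff (r : ℂ) : Fin 4 → ℕ × ℕ → ℂ :=
  ![h5Coeff r (-r) (1 / 2), h5Coeff (r + 1 / 2) (-r + 1 / 2) (3 / 2),
    coneCoeff (-r) (1 - r) (1 / 2), coneCoeff (3 / 2 - r) (3 / 2 - r) (3 / 2)]

theorem injective_cone : Function.Injective fun k : ℕ × ℕ => (k.1 + k.2, k.2) := by
  rintro ⟨m, n⟩ ⟨m', n'⟩ h
  simp only [Prod.mk.injEq] at h ⊢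
  omega

theorem coneCoeff_term (e d c x y : ℂ) (k : ℕ × ℕ) :
    coneCoeff e d c (k.1 + k.2, k.2) * x ^ (k.1 + k.2) * y ^ k.2
      = poch e (2 * k.1 + 3 * k.2)
        / (poch c k.2 * poch d (k.1 + k.2) * (k.1.factorial : ℂ) * (k.2.factorial : ℂ))
        * (-x) ^ k.1 * (x * y) ^ k.2 := by
  rw [coneCoeff_add, show 2 * (k.1 + k.2) + k.2 = 2 * k.1 + 3 * k.2 by ring, neg_pow x, mul_pow,
    pow_add]
  ring

theorem tsum_coneCoeff (e d c : ℂ) (p : ℂ × ℂ) :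
    ∑' k : ℕ × ℕ, coneCoeff e d c (k.1 + k.2, k.2) * p.1 ^ (k.1 + k.2) * p.2 ^ k.2
      = doubleSeries (coneCoeff e d c) p := by
  refine injective_cone.tsum_eq (f := fun k => coneCoeff e d c k * p.1 ^ k.1 * p.2 ^ k.2) ?_
  rintro ⟨m, n⟩ hk
  rcases lt_or_ge m n with h | h
  · simp [coneCoeff_of_lt _ _ _ h] at hk
  · exact ⟨(m - n, n), by simp [h]⟩

theorem Phi3Term_eq (r x y : ℂ) (k : ℕ × ℕ) : Phi3Term r x y k
    = coneCoeff (-r) (1 - r) (1 / 2) (k.1 + k.2, k.2) * x ^ (k.1 + k.2) * y ^ k.2 :=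
  (coneCoeff_term _ _ _ x y k).symm

theorem Phi4Term_eq (r x y : ℂ) (k : ℕ × ℕ) : Phi4Term r x y k
    = coneCoeff (3 / 2 - r) (3 / 2 - r) (3 / 2) (k.1 + k.2, k.2)
      * x ^ (k.1 + k.2) * y ^ k.2 := by
  rw [coneCoeff_term, Phi4Term, mul_comm (poch (3 / 2 - r) (k.1 + k.2))]

theorem Phi_eq_frobenius (r : ℂ) (i : Fin 4) :
    Phi r i = frobenius (phiExpX r i) (phiExpY i) (phiCoeff r i) := by
  funext p
  fin_cases i
  · change Phi1 r p = p.1 ^ (0 : ℂ) * p.2 ^ (0 : ℂ) * Phi1 r p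
    simp
  · change p.2 ^ (1 / 2 : ℂ) * _ = p.1 ^ (0 : ℂ) * p.2 ^ (1 / 2 : ℂ) * _
    rw [Complex.cpow_zero, one_mul]
    rfl
  · change p.1 ^ (-r) * ∑' k, Phi3Term r p.1 p.2 k = p.1 ^ (-r) * p.2 ^ (0 : ℂ) * _
    simp only [Phi3Term_eq, tsum_coneCoeff, Complex.cpow_zero, mul_one]
    rfl
  · change p.1 ^ (-r + 1 / 2) * p.2 ^ (1 / 2 : ℂ) * ∑' k, Phi4Term r p.1 p.2 k = _
    simp only [Phi4Term_eq, tsum_coneCoeff]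
    rfl

theorem phiCoeff_zero (r : ℂ) (i : Fin 4) : phiCoeff r i (0, 0) = 1 := by
  fin_cases i <;> simp [phiCoeff, h5Coeff, coneCoeff, poch_zero, pochInt]

theorem one_half_add_natCast_ne_zero (j : ℕ) : (1 / 2 : ℂ) + j ≠ 0 := fun h => by
  have : ((2 * j + 1 : ℕ) : ℂ) = 0 := by push_cast; linear_combination 2 * h
  exact_mod_cast this

theorem three_halves_add_natCast_ne_zero (j : ℕ) : (3 / 2 : ℂ) + j ≠ 0 := fun h =>
  one_half_add_natCast_ne_zero (j + 1) (by push_cast; linear_combination h)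

theorem neg_add_half_int_ne_intCast (hr : ∀ k : ℤ, 2 * r ≠ k) (s k : ℤ) : -r + s / 2 ≠ k :=
  fun h => hr (s - 2 * k) (by push_cast; linear_combination -2 * h)

theorem one_sub_ne_intCast (hr : ∀ k : ℤ, 2 * r ≠ k) (k : ℤ) : 1 - r ≠ k := fun h =>
  neg_add_half_int_ne_intCast hr 2 k (by push_cast; linear_combination h)

theorem three_halves_sub_ne_intCast (hr : ∀ k : ℤ, 2 * r ≠ k) (k : ℤ) : 3 / 2 - r ≠ k :=
  fun h => neg_add_half_int_ne_intCast hr 3 k (by push_cast; linear_combination h)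

theorem neg_ne_intCast (hr : ∀ k : ℤ, 2 * r ≠ k) (k : ℤ) : -r ≠ k := by
  simpa using neg_add_half_int_ne_intCast hr 0 k

theorem neg_add_half_ne_intCast (hr : ∀ k : ℤ, 2 * r ≠ k) (k : ℤ) : -r + 1 / 2 ≠ k := by
  simpa using neg_add_half_int_ne_intCast hr 1 k

theorem convergesBelow_phiCoeff (hr : ∀ k : ℤ, 2 * r ≠ k) (i : Fin 4) :
    ConvergesBelow 256⁻¹ (phiCoeff r i) := by
  fin_cases i
  · exact convergesBelow_h5Coeff _ (neg_ne_intCast hr) one_half_add_natCast_ne_zero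
  · exact convergesBelow_h5Coeff _ (neg_add_half_ne_intCast hr) three_halves_add_natCast_ne_zero
  · exact convergesBelow_coneCoeff _ (add_natCast_ne_zero (one_sub_ne_intCast hr))
      one_half_add_natCast_ne_zero
  · exact convergesBelow_coneCoeff _ (add_natCast_ne_zero (three_halves_sub_ne_intCast hr))
      three_halves_add_natCast_ne_zero

theorem summable_Phi_terms (hr : ∀ k : ℤ, 2 * r ≠ k) {x y : ℂ} (hx : ‖x‖ < 256⁻¹)
    (hy : ‖y‖ < 256⁻¹) :
    Summable (H5Term r (-r) (1 / 2) x y) ∧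
    Summable (H5Term (r + 1 / 2) (-r + 1 / 2) (3 / 2) x y) ∧
    Summable (Phi3Term r x y) ∧ Summable (Phi4Term r x y) := by
  have hsum := fun i => (convergesBelow_phiCoeff hr i).summable hx hy
  exact ⟨hsum 0, hsum 1,
    ((hsum 2).comp_injective injective_cone).congr fun k => (Phi3Term_eq r x y k).symm,
    ((hsum 3).comp_injective injective_cone).congr fun k => (Phi4Term_eq r x y k).symm⟩

theorem isHornSolution_Phi (hr : ∀ k : ℤ, 2 * r ≠ k) (i : Fin 4) :
    IsHornSolution r (-r) (1 / 2) (domXY 256⁻¹) (Phi r i) := by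
  rw [Phi_eq_frobenius]
  fin_cases i
  · exact isHornSolution_frobenius_h5Coeff (σ := 0) (by ring) (by ring) (by ring)
      (by ring) (neg_ne_intCast hr) one_half_add_natCast_ne_zero
  · exact isHornSolution_frobenius_h5Coeff (σ := 1 / 2) (by ring) (by ring) (by ring)
      (by ring) (neg_add_half_ne_intCast hr) three_halves_add_natCast_ne_zero
  · exact isHornSolution_frobenius_coneCoeff (ρ := -r) (σ := 0) (by ring) (by ring)
      (by ring) (by ring) (by ring) (add_natCast_ne_zero (one_sub_ne_intCast hr))
      one_half_add_natCast_ne_zero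
  · exact isHornSolution_frobenius_coneCoeff (ρ := -r + 1 / 2) (σ := 1 / 2) (by ring) (by ring)
      (by ring) (by ring) (by ring) (add_natCast_ne_zero (three_halves_sub_ne_intCast hr))
      three_halves_add_natCast_ne_zero

end Solutions

section Estimates

variable {𝕜 ι κ E G : Type*} [Fintype ι]

theorem isBigO_of_mulVec_eq {X : Type*} [TopologicalSpace X] [NormedField 𝕜] [DecidableEq ι]
    [Fintype κ] {M : X → Matrix ι ι 𝕜} {N : X → Matrix ι κ 𝕜} {u : X → ι → 𝕜} {w : X → κ → 𝕜}
    {p : X} (hM : ContinuousAt M p) (hN : ContinuousAt N p) (hdet : (M p).det ≠ 0)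
    (h : ∀ᶠ q in 𝓝 p, (M q).mulVec (u q) = (N q).mulVec (w q)) : u =O[𝓝 p] w := by
  have hMinv : ContinuousAt (fun q => (M q)⁻¹) p :=
    (continuousAt_matrix_inv (M p) (by simpa using continuousAt_inv₀ hdet)).comp hM
  have hmul : Continuous fun A : Matrix ι ι 𝕜 × Matrix ι κ 𝕜 => A.1 * A.2 :=
    continuous_fst.matrix_mul continuous_snd
  have hinv : ContinuousAt (fun q => (M q)⁻¹ * N q) p :=
    hmul.continuousAt.comp' (hMinv.prodMk hN)
  have hu : u =ᶠ[𝓝 p] fun q => ((M q)⁻¹ * N q).mulVec (w q) := by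
    filter_upwards [h, (continuous_id.matrix_det.continuousAt.comp hM).eventually_ne hdet]
      with q hq hq'
    rw [← Matrix.mulVec_mulVec, ← hq, Matrix.mulVec_mulVec,
      Matrix.nonsing_inv_mul _ (Ne.isUnit (a := (M q).det) hq'), Matrix.one_mulVec]
  refine hu.trans_isBigO (Asymptotics.isBigO_pi.2 fun i => ?_)
  refine Asymptotics.IsBigO.fun_sum fun j _ => ?_
  have hentry : ContinuousAt (fun q => ((M q)⁻¹ * N q) i j) p :=
    continuousAt_pi.1 (continuousAt_pi.1 hinv i) j
  simpa using (hentry.norm.isBoundedUnder_le.isBigO_one ℝ).mul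
    ((Asymptotics.isBigO_pi.1 (Asymptotics.isBigO_refl w (𝓝 p)) j).norm_right)

theorem eventually_eq_zero_of_hasFDerivAt_isBigO [NormedAddCommGroup E] [NormedSpace ℝ E]
    [NormedAddCommGroup G] [NormedSpace ℝ G] {J : E → G} {J' : E → E →L[ℝ] G} {p : E}
    (hJ : ∀ᶠ q in 𝓝 p, HasFDerivAt J (J' q) q) (hJ' : J' =O[𝓝 p] J) (h0 : J p = 0) :
    ∀ᶠ q in 𝓝 p, J q = 0 := by
  obtain ⟨K, hK⟩ := hJ'.bound
  obtain ⟨ρ, hρ, hball⟩ := Metric.eventually_nhds_iff_ball.1 (hJ.and hK)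
  refine Metric.eventually_nhds_iff_ball.2 ⟨ρ, hρ, fun q hq => ?_⟩
  have hmem : ∀ t ∈ Set.Icc (0 : ℝ) 1, p + t • (q - p) ∈ Metric.ball p ρ := fun t ht =>
    (convex_ball p ρ).add_smul_sub_mem (Metric.mem_ball_self hρ) hq ht
  have hderiv : ∀ t ∈ Set.Icc (0 : ℝ) 1, HasDerivAt (fun t : ℝ => J (p + t • (q - p)))
      (J' (p + t • (q - p)) (q - p)) t := fun t ht =>
    (hball _ (hmem t ht)).1.comp_hasDerivAt t
      (by simpa using ((hasDerivAt_id t).smul_const (q - p)).const_add p)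
  have h1 := eq_zero_of_abs_deriv_le_mul_abs_self_of_eq_zero_right (K := K * ‖q - p‖)
    (fun t ht => (hderiv t ht).continuousAt.continuousWithinAt)
    (fun t ht => (hderiv t (Set.Ico_subset_Icc_self ht)).hasDerivWithinAt) (by simpa using h0)
    (fun t ht => ?_) 1 (by simp)
  · simpa using h1
  calc ‖J' (p + t • (q - p)) (q - p)‖ ≤ ‖J' (p + t • (q - p))‖ * ‖q - p‖ :=
        ContinuousLinearMap.le_opNorm _ _
    _ ≤ K * ‖J (p + t • (q - p))‖ * ‖q - p‖ := by
        gcongr; exact (hball _ (hmem t (Set.Ico_subset_Icc_self ht))).2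
    _ = K * ‖q - p‖ * ‖J (p + t • (q - p))‖ := by ring

theorem eventually_eq_zero_of_fderiv_isBigO [NormedAddCommGroup E] [NormedSpace ℂ E]
    {J : E → ι → ℂ} {p : E} (hJ : ∀ i, AnalyticAt ℂ (fun q => J q i) p)
    (hJ' : ∀ i, fderiv ℂ (fun q => J q i) =O[𝓝 p] J) (h0 : J p = 0) :
    ∀ᶠ q in 𝓝 p, J q = 0 := by
  let _ : NormedSpace ℝ E := .restrictScalars ℝ ℂ E
  refine eventually_eq_zero_of_hasFDerivAt_isBigO
    (J' := fun q => (ContinuousLinearMap.pi fun i => fderiv ℂ (fun q => J q i) q).restrictScalars ℝ)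
    ?_ ?_ h0
  · filter_upwards [eventually_all.2 fun i => (hJ i).eventually_analyticAt] with q hq
    exact (hasFDerivAt_pi.2 fun i => (hq i).differentiableAt.hasFDerivAt).restrictScalars ℝ
  · refine .trans (.of_bound' (.of_forall fun q => ?_)) (Asymptotics.isBigO_pi.2 hJ')
    rw [ContinuousLinearMap.norm_restrictScalars]
    exact ContinuousLinearMap.norm_pi_le_of_le (norm_le_pi_norm _) (norm_nonneg _)

end Estimates

section HornOperators

variable {a b c : ℂ} {F : ℂ × ℂ → ℂ} {p : ℂ × ℂ} (α β : ℂ)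

/-- The first operator of the Horn system of `H₅(a, b, c | x, y)`. -/
noncomputable def hornX (a b : ℂ) (F : ℂ × ℂ → ℂ) (p : ℂ × ℂ) : ℂ :=
  thetaX (thetaLin (-1) 1 b F) p - p.1 * thetaLin 2 1 a (thetaLin 2 1 (a + 1) F) p

/-- The second operator of the Horn system of `H₅(a, b, c | x, y)`. -/
noncomputable def hornY (a b c : ℂ) (F : ℂ × ℂ → ℂ) (p : ℂ × ℂ) : ℂ :=
  thetaY (thetaLin 0 1 (c - 1) F) p - p.2 * thetaLin 2 1 a (thetaLin (-1) 1 b F) p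

theorem hornX_eq (h : AnalyticAt ℂ F p) :
    hornX a b F p = -thetaX (thetaX F) p + thetaX (thetaY F) p + b * thetaX F p
      - p.1 * (4 * thetaX (thetaX F) p + 4 * thetaX (thetaY F) p + thetaY (thetaY F) p
        + (4 * a + 2) * thetaX F p + (2 * a + 1) * thetaY F p + a * (a + 1) * F p) := by
  rw [hornX, thetaX_eq_thetaLin (thetaLin _ _ _ _), thetaLin_thetaLin _ _ _ _ _ _ h,
    thetaLin_thetaLin _ _ _ _ _ _ h]
  ring

theorem hornY_eq (h : AnalyticAt ℂ F p) :
    hornY a b c F p = thetaY (thetaY F) p + (c - 1) * thetaY F p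
      - p.2 * (-2 * thetaX (thetaX F) p + thetaX (thetaY F) p + thetaY (thetaY F) p
        + (2 * b - a) * thetaX F p + (a + b) * thetaY F p + a * b * F p) := by
  rw [hornY, thetaY_eq_thetaLin (thetaLin _ _ _ _), thetaLin_thetaLin _ _ _ _ _ _ h,
    thetaLin_thetaLin _ _ _ _ _ _ h]
  ring

theorem thetaLin_sub_mul {A B W : ℂ × ℂ → ℂ} (hA : DifferentiableAt ℂ A p)
    (hB : DifferentiableAt ℂ B p) (hW : DifferentiableAt ℂ W p) :
    thetaLin α β 0 (fun q => A q - W q * B q) p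
      = thetaLin α β 0 A p - W p * thetaLin α β 0 B p - thetaLin α β 0 W p * B p := by
  have hneg : thetaLin α β 0 (fun q => (-1) * (W q * B q)) p = _ :=
    thetaLin_mul α β 0 (differentiableAt_const (-1)) (hW.fun_mul hB)
  simp only [sub_eq_add_neg, neg_eq_neg_one_mul (W _ * B _)]
  rw [thetaLin_add _ _ _ hA ((hW.fun_mul hB).const_mul _), hneg, thetaLin_mul _ _ _ hW hB,
    thetaLin_const]
  ring

theorem thetaLin_thetaLin_comm (α₁ β₁ γ₁ α₂ β₂ γ₂ : ℂ) (h : AnalyticAt ℂ F p) :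
    thetaLin α₁ β₁ γ₁ (thetaLin α₂ β₂ γ₂ (thetaLin α β 0 F)) p
      = thetaLin α β 0 (thetaLin α₁ β₁ γ₁ (thetaLin α₂ β₂ γ₂ F)) p := by
  rw [thetaLin_congr _ _ _ (h.eventually_analyticAt.mono fun q hq =>
    thetaLin_comm α₂ β₂ γ₂ α β 0 hq), thetaLin_comm _ _ _ _ _ _ (analyticAt_thetaLin _ _ _ h)]

theorem hornX_thetaLin (h : AnalyticAt ℂ F p) :
    hornX a b (thetaLin α β 0 F) p
      = thetaLin α β 0 (hornX a b F) p
        + α * p.1 * thetaLin 2 1 a (thetaLin 2 1 (a + 1) F) p := by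
  have hd : ∀ α₁ β₁ γ₁ α₂ β₂ γ₂,
      DifferentiableAt ℂ (thetaLin α₁ β₁ γ₁ (thetaLin α₂ β₂ γ₂ F)) p := fun _ _ _ _ _ _ =>
    differentiableAt_thetaLin _ _ _ (analyticAt_thetaLin _ _ _ h)
  have hX : hornX a b F = fun q => thetaLin 1 0 0 (thetaLin (-1) 1 b F) q
      - q.1 * thetaLin 2 1 a (thetaLin 2 1 (a + 1) F) q :=
    funext fun q => by rw [hornX, thetaX_eq_thetaLin]
  rw [hX, thetaLin_sub_mul _ _ (hd _ _ _ _ _ _) (hd _ _ _ _ _ _) differentiableAt_fst,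
    thetaLin_fst, hornX, thetaX_eq_thetaLin, thetaLin_thetaLin_comm _ _ _ _ _ _ _ _ h,
    thetaLin_thetaLin_comm _ _ _ _ _ _ _ _ h]
  ring

theorem hornY_thetaLin (h : AnalyticAt ℂ F p) :
    hornY a b c (thetaLin α β 0 F) p
      = thetaLin α β 0 (hornY a b c F) p
        + β * p.2 * thetaLin 2 1 a (thetaLin (-1) 1 b F) p := by
  have hd : ∀ α₁ β₁ γ₁ α₂ β₂ γ₂,
      DifferentiableAt ℂ (thetaLin α₁ β₁ γ₁ (thetaLin α₂ β₂ γ₂ F)) p := fun _ _ _ _ _ _ =>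
    differentiableAt_thetaLin _ _ _ (analyticAt_thetaLin _ _ _ h)
  have hY : hornY a b c F = fun q => thetaLin 0 1 0 (thetaLin 0 1 (c - 1) F) q
      - q.2 * thetaLin 2 1 a (thetaLin (-1) 1 b F) q :=
    funext fun q => by rw [hornY, thetaY_eq_thetaLin]
  rw [hY, thetaLin_sub_mul _ _ (hd _ _ _ _ _ _) (hd _ _ _ _ _ _) differentiableAt_snd,
    thetaLin_snd, hornY, thetaY_eq_thetaLin, thetaLin_thetaLin_comm _ _ _ _ _ _ _ _ h,
    thetaLin_thetaLin_comm _ _ _ _ _ _ _ _ h]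
  ring

end HornOperators

section Rank

variable {a b c : ℂ} {U : Set (ℂ × ℂ)} {F G : ℂ × ℂ → ℂ} {p : ℂ × ℂ}

/-- The values at `p` of `F`, `θ_x F`, `θ_y F` and `θ_x θ_y F`, which are coordinates on the
solutions of the Horn system near a generic point. -/
noncomputable def jet (F : ℂ × ℂ → ℂ) (p : ℂ × ℂ) : Fin 4 → ℂ :=
  ![F p, thetaX F p, thetaY F p, thetaX (thetaY F) p]

/-- The coefficients of `θ_x²` and `θ_y²` in the two Horn operators. -/
def secondOrderMatrix (p : ℂ × ℂ) : Matrix (Fin 2) (Fin 2) ℂ :=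
  !![1 + 4 * p.1, p.1; 2 * p.2, 1 - p.2]

/-- The coefficients of `θ_x³, θ_x² θ_y, θ_x θ_y², θ_y³` in the products of `θ_x` and `θ_y` with the
two Horn operators. -/
def thirdOrderMatrix (p : ℂ × ℂ) : Matrix (Fin 4) (Fin 4) ℂ :=
  !![1 + 4 * p.1, 4 * p.1 - 1, p.1, 0;
    0, 1 + 4 * p.1, 4 * p.1 - 1, p.1;
    2 * p.2, -p.2, 1 - p.2, 0;
    0, 2 * p.2, -p.2, 1 - p.2]

theorem det_secondOrderMatrix (p : ℂ × ℂ) :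
    (secondOrderMatrix p).det = 1 + 4 * p.1 - p.2 - 6 * (p.1 * p.2) := by
  rw [secondOrderMatrix, Matrix.det_fin_two_of]
  ring

theorem det_thirdOrderMatrix (p : ℂ × ℂ) :
    (thirdOrderMatrix p).det
      = (1 + 4 * p.1) ^ 2 - p.2 - 36 * (p.1 * p.2) + 27 * (p.1 * p.2 ^ 2) := by
  simp [thirdOrderMatrix, Matrix.det_succ_row_zero, Fin.sum_univ_succ, Fin.succAbove]
  ring

theorem det_secondOrderMatrix_ne_zero (hx : ‖p.1‖ < 256⁻¹) (hy : ‖p.2‖ < 256⁻¹) :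
    (secondOrderMatrix p).det ≠ 0 := by
  rw [det_secondOrderMatrix]
  intro h
  have h1 : ‖(1 : ℂ)‖ = ‖p.2 + 6 * (p.1 * p.2) - 4 * p.1‖ := by
    congr 1
    linear_combination h
  have h2 : ‖p.2 + 6 * (p.1 * p.2) - 4 * p.1‖
      ≤ ‖p.2‖ + 6 * (‖p.1‖ * ‖p.2‖) + 4 * ‖p.1‖ := by
    refine norm_sub_le_of_le (norm_add_le_of_le le_rfl ?_) ?_ <;> simp
  rw [norm_one] at h1
  nlinarith [norm_nonneg p.1, norm_nonneg p.2]

theorem det_thirdOrderMatrix_ne_zero (hx : ‖p.1‖ < 256⁻¹) (hy : ‖p.2‖ < 256⁻¹) :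
    (thirdOrderMatrix p).det ≠ 0 := by
  rw [det_thirdOrderMatrix]
  intro h
  have h1 : ‖(1 : ℂ)‖ = ‖p.2 - 8 * p.1 - 16 * p.1 ^ 2 + 36 * (p.1 * p.2)
      - 27 * (p.1 * p.2 ^ 2)‖ := by
    congr 1
    linear_combination h
  have h2 : ‖p.2 - 8 * p.1 - 16 * p.1 ^ 2 + 36 * (p.1 * p.2) - 27 * (p.1 * p.2 ^ 2)‖
      ≤ ‖p.2‖ + 8 * ‖p.1‖ + 16 * ‖p.1‖ ^ 2 + 36 * (‖p.1‖ * ‖p.2‖)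
        + 27 * (‖p.1‖ * ‖p.2‖ ^ 2) := by
    refine norm_sub_le_of_le (norm_add_le_of_le (norm_sub_le_of_le (norm_sub_le_of_le
      le_rfl ?_) ?_) ?_) ?_ <;> simp
  have h3 : ‖p.1‖ * ‖p.2‖ ^ 2 ≤ ‖p.1‖ * ‖p.2‖ := by
    gcongr
    nlinarith [norm_nonneg p.2]
  rw [norm_one] at h1
  nlinarith [norm_nonneg p.1, norm_nonneg p.2]

theorem IsHornSolution.secondOrder_isBigO_jet (hF : IsHornSolution a b c U F) (hU : U ∈ 𝓝 p)
    (hdet : (secondOrderMatrix p).det ≠ 0) :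
    (fun q => ![thetaX (thetaX F) q, thetaY (thetaY F) q]) =O[𝓝 p] jet F := by
  let N : ℂ × ℂ → Matrix (Fin 2) (Fin 4) ℂ := fun q =>
    !![-a * (a + 1) * q.1, b - (4 * a + 2) * q.1, -(2 * a + 1) * q.1, 1 - 4 * q.1;
      a * b * q.2, (2 * b - a) * q.2, 1 - c + (a + b) * q.2, q.2]
  have hM : ContinuousAt secondOrderMatrix p := by
    change ContinuousAt (fun q => ![_, _]) p
    fun_prop
  have hN : ContinuousAt N p := by
    change ContinuousAt (fun q => ![_, _]) p
    fun_prop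
  refine isBigO_of_mulVec_eq hM hN hdet ?_
  filter_upwards [hU] with q hq
  have hx := (hornX_eq (hF.analytic q hq)).symm.trans (hF.eq_x q hq)
  have hy := (hornY_eq (hF.analytic q hq)).symm.trans (hF.eq_y q hq)
  ext i
  fin_cases i <;> simp [secondOrderMatrix, N, jet, Matrix.mulVec, dotProduct, Fin.sum_univ_succ]
  · linear_combination -hx
  · linear_combination hy

theorem thetaX_thetaY_thetaX (h : AnalyticAt ℂ F p) :
    thetaX (thetaY (thetaX F)) p = thetaX (thetaX (thetaY F)) p := by
  rw [thetaX_eq_thetaLin (thetaY _), thetaX_eq_thetaLin (thetaX (thetaY F))]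
  exact thetaLin_congr _ _ _ (h.eventually_analyticAt.mono fun q hq => thetaY_thetaX hq)

theorem thetaY_thetaY_thetaX (h : AnalyticAt ℂ F p) :
    thetaY (thetaY (thetaX F)) p = thetaX (thetaY (thetaY F)) p := by
  rw [← thetaY_thetaX (analyticAt_thetaY h), thetaY_eq_thetaLin (thetaY _),
    thetaY_eq_thetaLin (thetaX (thetaY F))]
  exact thetaLin_congr _ _ _ (h.eventually_analyticAt.mono fun q hq => thetaY_thetaX hq)

theorem IsHornSolution.hornX_thetaLin (hF : IsHornSolution a b c U F) (hU : U ∈ 𝓝 p) (α β : ℂ) :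
    hornX a b (thetaLin α β 0 F) p = α * p.1 * (4 * thetaX (thetaX F) p + 4 * thetaX (thetaY F) p
      + thetaY (thetaY F) p + (4 * a + 2) * thetaX F p + (2 * a + 1) * thetaY F p
      + a * (a + 1) * F p) := by
  have h := hF.analytic p (mem_of_mem_nhds hU)
  have h0 : hornX a b F =ᶠ[𝓝 p] fun _ => 0 := mem_of_superset hU hF.eq_x
  rw [HornH5.hornX_thetaLin _ _ h, thetaLin_congr _ _ _ h0, thetaLin_const,
    thetaLin_thetaLin _ _ _ _ _ _ h]
  ring

theorem IsHornSolution.hornY_thetaLin (hF : IsHornSolution a b c U F) (hU : U ∈ 𝓝 p) (α β : ℂ) :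
    hornY a b c (thetaLin α β 0 F) p = β * p.2 * (-2 * thetaX (thetaX F) p + thetaX (thetaY F) p
      + thetaY (thetaY F) p + (2 * b - a) * thetaX F p + (a + b) * thetaY F p + a * b * F p) := by
  have h := hF.analytic p (mem_of_mem_nhds hU)
  have h0 : hornY a b c F =ᶠ[𝓝 p] fun _ => 0 := mem_of_superset hU hF.eq_y
  rw [HornH5.hornY_thetaLin _ _ h, thetaLin_congr _ _ _ h0, thetaLin_const,
    thetaLin_thetaLin _ _ _ _ _ _ h]
  ring

theorem IsHornSolution.thirdOrder_isBigO (hF : IsHornSolution a b c U F) (hU : U ∈ 𝓝 p)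
    (hdet : (thirdOrderMatrix p).det ≠ 0) :
    (fun q => ![thetaX (thetaX (thetaX F)) q, thetaX (thetaX (thetaY F)) q,
      thetaX (thetaY (thetaY F)) q, thetaY (thetaY (thetaY F)) q]) =O[𝓝 p]
    fun q => ![F q, thetaX F q, thetaY F q, thetaX (thetaX F) q, thetaX (thetaY F) q,
      thetaY (thetaY F) q] := by
  let N : ℂ × ℂ → Matrix (Fin 4) (Fin 6) ℂ := fun q =>
    !![-a * (a + 1) * q.1, -(a ^ 2 + 5 * a + 2) * q.1, -(2 * a + 1) * q.1, b - (4 * a + 6) * q.1,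
        -(2 * a + 5) * q.1, -q.1;
      0, 0, -a * (a + 1) * q.1, 0, b - (4 * a + 2) * q.1, -(2 * a + 1) * q.1;
      0, a * b * q.2, 0, (2 * b - a) * q.2, 1 - c + (a + b) * q.2, 0;
      a * b * q.2, (2 * b - a) * q.2, (a + b + a * b) * q.2, -2 * q.2, (2 * b - a + 1) * q.2,
        1 - c + (a + b + 1) * q.2]
  have hM : ContinuousAt thirdOrderMatrix p := by
    change ContinuousAt (fun q => ![_, _, _, _]) p
    fun_prop
  have hN : ContinuousAt N p := by
    change ContinuousAt (fun q => ![_, _, _, _]) p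
    fun_prop
  refine isBigO_of_mulVec_eq hM hN hdet ?_
  filter_upwards [eventually_mem_nhds_iff.2 hU] with q hq
  have h := hF.analytic q (mem_of_mem_nhds hq)
  have hXX := hF.hornX_thetaLin hq 1 0
  have hXY := hF.hornX_thetaLin hq 0 1
  have hYX := hF.hornY_thetaLin hq 1 0
  have hYY := hF.hornY_thetaLin hq 0 1
  rw [← thetaX_eq_thetaLin, hornX_eq (analyticAt_thetaX h), thetaX_thetaY_thetaX h,
    thetaY_thetaY_thetaX h, thetaY_thetaX h] at hXX
  rw [← thetaY_eq_thetaLin, hornX_eq (analyticAt_thetaY h)] at hXY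
  rw [← thetaX_eq_thetaLin, hornY_eq (analyticAt_thetaX h), thetaX_thetaY_thetaX h,
    thetaY_thetaY_thetaX h, thetaY_thetaX h] at hYX
  rw [← thetaY_eq_thetaLin, hornY_eq (analyticAt_thetaY h)] at hYY
  ext i
  fin_cases i <;> simp [thirdOrderMatrix, N, Matrix.mulVec, dotProduct, Fin.sum_univ_succ]
  · linear_combination -hXX
  · linear_combination -hXY
  · linear_combination hYX
  · linear_combination hYY

theorem fderiv_isBigO {E : Type*} [NormedAddCommGroup E] {u : ℂ × ℂ → E}
    (hG : AnalyticAt ℂ G p) (hx : p.1 ≠ 0) (hy : p.2 ≠ 0) (hX : thetaX G =O[𝓝 p] u)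
    (hY : thetaY G =O[𝓝 p] u) : fderiv ℂ G =O[𝓝 p] u := by
  have hfst := continuousAt_fst (p := p)
  have hsnd := continuousAt_snd (p := p)
  have hsplit : fderiv ℂ G =ᶠ[𝓝 p] fun q => (q.1⁻¹ * thetaX G q) • ContinuousLinearMap.fst ℂ ℂ ℂ
      + (q.2⁻¹ * thetaY G q) • ContinuousLinearMap.snd ℂ ℂ ℂ := by
    filter_upwards [hG.eventually_analyticAt, hfst.eventually_ne hx, hsnd.eventually_ne hy]
      with q hq hqx hqy
    rw [thetaX, thetaY, (hasDerivAt_slice_fst hq.differentiableAt).deriv,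
      (hasDerivAt_slice_snd hq.differentiableAt).deriv, inv_mul_cancel_left₀ hqx,
      inv_mul_cancel_left₀ hqy]
    ext <;> simp
  have hmul : ∀ {g W : ℂ × ℂ → ℂ} (A : ℂ × ℂ →L[ℂ] ℂ), ContinuousAt g p → W =O[𝓝 p] u →
      (fun q => (g q * W q) • A) =O[𝓝 p] u := fun A hg hW => by
    simpa using ((hg.norm.isBoundedUnder_le.isBigO_one ℝ).mul hW.norm_right).smul
      (Asymptotics.isBigO_const_const A (one_ne_zero (α := ℝ)) (𝓝 p))
  exact hsplit.trans_isBigO ((hmul _ (hfst.inv₀ hx) hX).add (hmul _ (hsnd.inv₀ hy) hY))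

theorem IsHornSolution.eventually_jet_eq_zero (hF : IsHornSolution a b c U F) (hU : U ∈ 𝓝 p)
    (hx : p.1 ≠ 0) (hy : p.2 ≠ 0) (hdet₂ : (secondOrderMatrix p).det ≠ 0)
    (hdet₃ : (thirdOrderMatrix p).det ≠ 0) (h0 : jet F p = 0) : ∀ᶠ q in 𝓝 p, jet F q = 0 := by
  have h := hF.analytic p (mem_of_mem_nhds hU)
  have hjet : ∀ i, (fun q => jet F q i) =O[𝓝 p] jet F :=
    Asymptotics.isBigO_pi.1 (Asymptotics.isBigO_refl _ _)
  have h2 := Asymptotics.isBigO_pi.1 (hF.secondOrder_isBigO_jet hU hdet₂)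
  have h3 := Asymptotics.isBigO_pi.1 ((hF.thirdOrder_isBigO hU hdet₃).trans
    (Asymptotics.isBigO_pi.2 fun i => show _ =O[𝓝 p] jet F by
      fin_cases i <;> [exact hjet 0; exact hjet 1; exact hjet 2; exact h2 0; exact hjet 3;
        exact h2 1]))
  have hYX : thetaY (thetaX F) =ᶠ[𝓝 p] thetaX (thetaY F) :=
    h.eventually_analyticAt.mono fun q hq => thetaY_thetaX hq
  have hYXY : thetaY (thetaX (thetaY F)) =ᶠ[𝓝 p] thetaX (thetaY (thetaY F)) :=
    h.eventually_analyticAt.mono fun q hq => thetaY_thetaX (analyticAt_thetaY hq)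
  refine eventually_eq_zero_of_fderiv_isBigO (fun i => ?_) (fun i => ?_) h0
  · fin_cases i <;> [exact h; exact analyticAt_thetaX h; exact analyticAt_thetaY h;
      exact analyticAt_thetaX (analyticAt_thetaY h)]
  · fin_cases i
    · exact fderiv_isBigO h hx hy (hjet 1) (hjet 2)
    · exact fderiv_isBigO (analyticAt_thetaX h) hx hy (h2 0) (hYX.trans_isBigO (hjet 3))
    · exact fderiv_isBigO (analyticAt_thetaY h) hx hy (hjet 3) (h2 1)
    · exact fderiv_isBigO (analyticAt_thetaX (analyticAt_thetaY h)) hx hy (h3 1)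
        (hYXY.trans_isBigO (h3 2))

theorem IsHornSolution.eqOn_zero_of_jet_eq_zero (hF : IsHornSolution a b c U F) (hU : IsOpen U)
    (hUc : IsPreconnected U) (hp : p ∈ U) (hx : p.1 ≠ 0) (hy : p.2 ≠ 0)
    (hdet₂ : (secondOrderMatrix p).det ≠ 0) (hdet₃ : (thirdOrderMatrix p).det ≠ 0)
    (h0 : jet F p = 0) : Set.EqOn F 0 U :=
  hF.analytic.eqOn_zero_of_preconnected_of_eventuallyEq_zero hUc hp
    ((hF.eventually_jet_eq_zero (hU.mem_nhds hp) hx hy hdet₂ hdet₃ h0).mono fun _ hq =>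
      congrFun hq 0)

end Rank

section RootBranch

open Complex (I)

variable {ε : ℝ} {v : ℂ × ℂ → ℂ}

theorem exists_analyticAt_implicit {E : Type*} [NormedAddCommGroup E] [NormedSpace ℂ E]
    [CompleteSpace E] {f : E × ℂ → ℂ} {p : E} {w d : ℂ} (hf : AnalyticAt ℂ f (p, w))
    (hd : HasDerivAt (fun t => f (p, t)) d w) (hd0 : d ≠ 0) :
    ∃ v : E → ℂ, AnalyticAt ℂ v p ∧ v p = w ∧ ∀ᶠ q in 𝓝 p, f (q, v q) = f (p, w) := by
  have cdf : ContDiffAt ℂ ⊤ f (p, w) := hf.contDiffAt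
  have hn : (⊤ : WithTop ℕ∞) ≠ 0 := WithTop.top_ne_zero
  have hderiv : (fderiv ℂ f (p, w) ∘L .inr ℂ E ℂ) 1 = d :=
    (hf.differentiableAt.hasFDerivAt.comp_hasDerivAt w
      ((hasDerivAt_const w p).prodMk (hasDerivAt_id w))).unique hd
  have hinv : (fderiv ℂ f (p, w) ∘L .inr ℂ E ℂ).IsInvertible := by
    refine ⟨ContinuousLinearEquiv.unitsEquivAut ℂ (Units.mk0 d hd0), ?_⟩
    ext
    rw [hderiv]
    simp
  exact ⟨cdf.implicitFunction hn hinv, (cdf.contDiffAt_implicitFunction hn hinv).analyticAt,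
    cdf.implicitFunction_apply_self hn hinv, cdf.eventually_apply_implicitFunction hn hinv⟩

theorem cpow_half_sq (y : ℂ) : (y ^ (1 / 2 : ℂ)) ^ 2 = y := by
  rw [one_div]
  exact Complex.cpow_ofNat_inv_pow y 2

theorem norm_cpow_half_sq (y : ℂ) : ‖y ^ (1 / 2 : ℂ)‖ ^ 2 = ‖y‖ := by
  rw [← norm_pow, cpow_half_sq]

theorem isPreconnected_ball_inter_slitPlane (ε : ℝ) :
    IsPreconnected (Metric.ball (0 : ℂ) ε ∩ Complex.slitPlane) := by
  rcases le_or_gt ε 0 with hε | hε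
  · rw [Metric.ball_eq_empty.2 hε, Set.empty_inter]
    exact isPreconnected_empty
  have hball : ((ε / 2 : ℝ) : ℂ) ∈ Metric.ball (0 : ℂ) ε := by
    rw [mem_ball_zero_iff, Complex.norm_real, Real.norm_of_nonneg (by positivity)]
    linarith
  exact ((((convex_ball (0 : ℂ) ε).starConvex hball).inter
    (Complex.starConvex_ofReal_slitPlane (half_pos hε))).isPathConnected
      ⟨hball, Complex.ofReal_mem_slitPlane.2 (half_pos hε)⟩).isConnected.isPreconnected

theorem domY_eq_prod (ε : ℝ) :
    domY ε = Metric.ball (0 : ℂ) ε ×ˢ (Metric.ball (0 : ℂ) ε ∩ Complex.slitPlane) := by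
  ext p
  simp [domY]

theorem isPreconnected_domY (ε : ℝ) : IsPreconnected (domY ε) := by
  rw [domY_eq_prod]
  exact (convex_ball _ _).isPreconnected.prod (isPreconnected_ball_inter_slitPlane ε)

theorem sq_mem_slitPlane {s : ℂ} (hs : 0 < s.re) : s ^ 2 ∈ Complex.slitPlane := by
  rw [Complex.mem_slitPlane_iff, sq, Complex.mul_re, Complex.mul_im]
  by_cases h : s.im = 0
  · exact Or.inl (by simpa [h] using mul_pos hs hs)
  · refine Or.inr fun h' => mul_ne_zero hs.ne' h ?_
    linarith

/-- The bidisc of the `(x, s)` with `|x|, |s²| < ε`, on which `s = √y` is a coordinate. -/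
def sqrtDisc (ε : ℝ) : Set (ℂ × ℂ) := {q | ‖q.1‖ < ε ∧ ‖q.2‖ ^ 2 < ε}

theorem sqrtDisc_eq_prod (ε : ℝ) :
    sqrtDisc ε = Metric.ball (0 : ℂ) ε ×ˢ Metric.ball (0 : ℂ) √ε := by
  ext q
  simp [sqrtDisc, Real.lt_sqrt (norm_nonneg q.2)]

theorem isOpen_sqrtDisc (ε : ℝ) : IsOpen (sqrtDisc ε) := by
  rw [sqrtDisc_eq_prod]
  exact Metric.isOpen_ball.prod Metric.isOpen_ball

theorem isPreconnected_sqrtDisc (ε : ℝ) : IsPreconnected (sqrtDisc ε) := by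
  rw [sqrtDisc_eq_prod]
  exact (convex_ball _ _).isPreconnected.prod (convex_ball _ _).isPreconnected

theorem zero_mem_sqrtDisc (hε : 0 < ε) : 0 ∈ sqrtDisc ε := ⟨by simpa, by simpa⟩

theorem prodMk_cpow_half_mem_sqrtDisc {p : ℂ × ℂ} (hp : p ∈ domY ε) :
    (p.1, p.2 ^ (1 / 2 : ℂ)) ∈ sqrtDisc ε :=
  ⟨hp.1, (norm_cpow_half_sq p.2).trans_lt hp.2.1⟩

theorem prodMk_sq_mem_domY {q : ℂ × ℂ} (hq : q ∈ sqrtDisc ε) (hs : 0 < q.2.re) :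
    (q.1, q.2 ^ 2) ∈ domY ε :=
  ⟨hq.1, (norm_pow q.2 2).trans_lt hq.2, sq_mem_slitPlane hs⟩

/-- `v` is a holomorphic square root near `1` of a root of the quartic, as a function of `x` and
`s = √y`. In terms of `v` the quartic splits into two factors, exchanged by `s ↦ -s`. -/
structure IsRootSqrt (ε : ℝ) (v : ℂ × ℂ → ℂ) : Prop where
  analytic : AnalyticOnNhd ℂ v (sqrtDisc ε)
  re_pos : ∀ q ∈ sqrtDisc ε, 0 < (v q).re
  root : ∀ q ∈ sqrtDisc ε, q.1 * v q ^ 4 + v q ^ 2 - 1 - 2 * I * q.2 * v q = 0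

theorem exists_isRootSqrt {R : ℝ} (hR : 0 < R) : ∃ ε, 0 < ε ∧ ε ≤ R ∧ ∃ v, IsRootSqrt ε v := by
  let f : (ℂ × ℂ) × ℂ → ℂ := fun u => u.1.1 * u.2 ^ 4 + u.2 ^ 2 - 1 - 2 * I * u.1.2 * u.2
  have hf : AnalyticAt ℂ f (0, 1) := by
    have : ContDiff ℂ ⊤ f := by fun_prop
    exact this.contDiffAt.analyticAt
  have hd : HasDerivAt (fun t => f (0, t)) 2 1 := by
    simpa [f] using (hasDerivAt_pow 2 (1 : ℂ)).sub_const 1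
  obtain ⟨v, hv, hv0, hroot⟩ := exists_analyticAt_implicit hf hd two_ne_zero
  have hre : ∀ᶠ q in 𝓝 0, 0 < (v q).re :=
    (Complex.continuous_re.continuousAt.comp hv.continuousAt).eventually_const_lt
      (by simp [hv0])
  obtain ⟨δ, hδ, h⟩ := Metric.eventually_nhds_iff_ball.1
    (hv.eventually_analyticAt.and (hre.and hroot))
  have hball : ∀ q ∈ sqrtDisc (min R (min δ (δ ^ 2))), q ∈ Metric.ball 0 δ := fun q hq => by
    simp only [sqrtDisc, Set.mem_ofPred_eq, lt_min_iff] at hq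
    rw [mem_ball_zero_iff, Prod.norm_def]
    exact max_lt hq.1.2.1 (lt_of_pow_lt_pow_left₀ 2 hδ.le hq.2.2.2)
  exact ⟨min R (min δ (δ ^ 2)), by positivity, min_le_left _ _, v, fun q hq => (h q (hball q hq)).1,
    fun q hq => (h q (hball q hq)).2.1, fun q hq => (h q (hball q hq)).2.2.trans (by simp [f])⟩

namespace IsRootSqrt

theorem map_zero (hv : IsRootSqrt ε v) (hε : 0 < ε) : v 0 = 1 := by
  have hre := hv.re_pos 0 (zero_mem_sqrtDisc hε)
  have hsq : v 0 ^ 2 = 1 := by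
    linear_combination (by simpa using hv.root 0 (zero_mem_sqrtDisc hε) : v 0 ^ 2 - 1 = 0)
  refine (sq_eq_one_iff.1 hsq).resolve_right fun h => ?_
  norm_num [h] at hre

theorem expansion (hv : IsRootSqrt ε v) (hε : 0 < ε) :
    (fun q => v q ^ 2 - (1 + 2 * I * q.2)) =O[𝓝 0] fun q => ‖q.1‖ + ‖q.2‖ ^ 2 := by
  have hv0 := hv.analytic 0 (zero_mem_sqrtDisc hε)
  have hsub : (fun q => v q - 1) =O[𝓝 0] fun q => q := by
    simpa [hv.map_zero hε] using hv0.differentiableAt.isBigO_sub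
  have hfst : (fun q : ℂ × ℂ => q.1 * v q ^ 4) =O[𝓝 0] fun q => ‖q.1‖ + ‖q.2‖ ^ 2 := by
    have hx : (fun q : ℂ × ℂ => q.1) =O[𝓝 0] fun q => ‖q.1‖ + ‖q.2‖ ^ 2 :=
      Asymptotics.IsBigO.of_bound 1 (Eventually.of_forall fun q => by
        rw [one_mul, Real.norm_of_nonneg (by positivity)]
        exact le_add_of_nonneg_right (by positivity))
    simpa using hx.mul ((hv0.continuousAt.pow 4).norm.isBoundedUnder_le.isBigO_one ℝ)
  have hsnd : (fun q : ℂ × ℂ => q.2 * (v q - 1)) =O[𝓝 0] fun q => ‖q.1‖ + ‖q.2‖ ^ 2 := by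
    refine ((Asymptotics.isBigO_refl (fun q : ℂ × ℂ => q.2) (𝓝 0)).norm_right.mul
      hsub.norm_right).trans (Asymptotics.IsBigO.of_bound 1 ?_)
    filter_upwards [Metric.ball_mem_nhds 0 one_pos] with q hq
    have hq2 : ‖q.2‖ ≤ 1 := (norm_snd_le q).trans (mem_ball_zero_iff.1 hq).le
    rw [one_mul, Real.norm_of_nonneg (by positivity), Real.norm_of_nonneg (by positivity),
      Prod.norm_def, mul_max_of_nonneg _ _ (norm_nonneg _)]
    refine max_le ?_ ?_ <;> nlinarith [norm_nonneg q.1, norm_nonneg q.2]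
  refine ((hsnd.const_mul_left (2 * I)).sub hfst).congr' ?_ EventuallyEq.rfl
  filter_upwards [(isOpen_sqrtDisc ε).mem_nhds (zero_mem_sqrtDisc hε)] with q hq
  linear_combination -hv.root q hq

end IsRootSqrt

/-- The root of the quartic with square root `v`. -/
noncomputable def rootOf (v : ℂ × ℂ → ℂ) (p : ℂ × ℂ) : ℂ := v (p.1, p.2 ^ (1 / 2 : ℂ)) ^ 2

theorem tendsto_cpow_half_zero : Tendsto (fun y : ℂ => y ^ (1 / 2 : ℂ)) (𝓝 0) (𝓝 0) := by
  have h := Complex.continuousAt_cpow_const_of_re_pos (z := 0) (w := 1 / 2) (by simp) (by simp)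
  simpa [ContinuousAt] using h

theorem isRootBranch_rootOf (hv : IsRootSqrt ε v) (hε : 0 < ε) :
    IsRootBranch ε (rootOf v) where
  analytic p hp := by
    have hs : AnalyticAt ℂ (fun p : ℂ × ℂ => (p.1, p.2 ^ (1 / 2 : ℂ))) p :=
      analyticAt_fst.prod (analyticAt_snd.cpow analyticAt_const hp.2.2)
    have hvp := hv.analytic _ (prodMk_cpow_half_mem_sqrtDisc hp)
    exact (AnalyticAt.comp (f := fun p : ℂ × ℂ => (p.1, p.2 ^ (1 / 2 : ℂ))) hvp hs).pow 2
  root p hp := by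
    have hr := hv.root _ (prodMk_cpow_half_mem_sqrtDisc hp)
    have hs := cpow_half_sq p.2
    rw [isQuarticRoot_iff, resolvent, rootOf]
    simp only at hr
    set s := p.2 ^ (1 / 2 : ℂ)
    set w := v (p.1, s)
    linear_combination (p.1 * w ^ 4 + w ^ 2 - 1 + 2 * I * s * w) * hr
      + 4 * s ^ 2 * w ^ 2 * Complex.I_sq - 4 * w ^ 2 * hs
  expansion := by
    have hlim : Tendsto (fun p : ℂ × ℂ => (p.1, p.2 ^ (1 / 2 : ℂ))) (𝓝 0) (𝓝 0) :=
      (continuous_fst.tendsto 0).prodMk_nhds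
        (tendsto_cpow_half_zero.comp (continuous_snd.tendsto 0))
    refine (((hv.expansion hε).comp_tendsto hlim).mono nhdsWithin_le_nhds).congr
      (fun p => rfl) fun p => ?_
    rw [Function.comp_apply, norm_cpow_half_sq]

/-- The points of `domY ε` at which `√y` dominates `x`, so that the terms `± 2 i √y` separate the
two roots of the quartic near `1`. -/
def sector (ε : ℝ) : Set (ℂ × ℂ) := {p | p ∈ domY ε ∧ ‖p.1‖ < ‖p.2‖}

theorem isOpen_sector (ε : ℝ) : IsOpen (sector ε) :=
  (isOpen_domY ε).inter (isOpen_lt continuous_fst.norm continuous_snd.norm)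

theorem nhdsWithin_sector_neBot (hε : 0 < ε) : (𝓝[sector ε] 0).NeBot := by
  refine mem_closure_iff_nhdsWithin_neBot.1 (Metric.mem_closure_iff.2 fun η hη => ?_)
  obtain ⟨t, ht0, ht⟩ := exists_between (lt_min hε hη)
  have ht' : ‖(t : ℂ)‖ = t := by rw [Complex.norm_real, Real.norm_of_nonneg ht0.le]
  have htε := ht.trans_le (min_le_left _ _)
  refine ⟨(0, t), ⟨⟨by simpa using hε, ht'.trans_lt htε, Complex.ofReal_mem_slitPlane.2 ht0⟩, ?_⟩,
    ?_⟩
  · simpa using ht0.ne'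
  · simpa [Prod.dist_eq, abs_of_pos ht0] using ⟨hη, ht.trans_le (min_le_right _ _)⟩

theorem tendsto_cpow_half_sector :
    Tendsto (fun p : ℂ × ℂ => p.2 ^ (1 / 2 : ℂ)) (𝓝[sector ε] 0) (𝓝 0) :=
  tendsto_cpow_half_zero.comp ((continuous_snd.tendsto 0).mono_left nhdsWithin_le_nhds)

theorem cpow_half_ne_zero_of_mem_sector {p : ℂ × ℂ} (hp : p ∈ sector ε) :
    p.2 ^ (1 / 2 : ℂ) ≠ 0 := fun h => by
  have := Complex.slitPlane_ne_zero hp.1.2.2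
  rw [← cpow_half_sq p.2, h] at this
  simp at this

theorem fst_isBigO_sector : (fun p : ℂ × ℂ => p.1) =O[𝓝[sector ε] 0] fun p => p.2 :=
  Asymptotics.IsBigO.of_bound' (eventually_mem_nhdsWithin.mono fun _ hp => hp.2.le)

theorem snd_isLittleO_sector :
    (fun p : ℂ × ℂ => p.2) =o[𝓝[sector ε] 0] fun p => p.2 ^ (1 / 2 : ℂ) := by
  refine (((Asymptotics.isLittleO_one_iff ℂ).2 tendsto_cpow_half_sector).mul_isBigO
    (Asymptotics.isBigO_refl (fun p : ℂ × ℂ => p.2 ^ (1 / 2 : ℂ)) _)).congr (fun p => ?_)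
    fun p => one_mul _
  rw [← sq, cpow_half_sq]

namespace IsRootBranch

variable {f g : ℂ × ℂ → ℂ}

theorem tendsto_sub_one_div (hf : IsRootBranch ε f) :
    Tendsto (fun p => (f p - 1) / p.2 ^ (1 / 2 : ℂ)) (𝓝[sector ε] 0) (𝓝 (2 * I)) := by
  have hsub : sector ε ⊆ domY ε := fun _ hp => hp.1
  have hO := (hf.expansion.mono (nhdsWithin_mono 0 hsub)).trans_isLittleO
    ((fst_isBigO_sector.norm_left.add (Asymptotics.isBigO_refl _ _).norm_left).trans_isLittleO
      snd_isLittleO_sector)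
  refine (zero_add (2 * I) ▸ hO.tendsto_div_nhds_zero.add_const (2 * I)).congr' ?_
  filter_upwards [self_mem_nhdsWithin] with p hp
  have := cpow_half_ne_zero_of_mem_sector hp
  field_simp
  ring

theorem tendsto_one (hf : IsRootBranch ε f) : Tendsto f (𝓝[sector ε] 0) (𝓝 1) := by
  have h := (hf.tendsto_sub_one_div.mul tendsto_cpow_half_sector).add_const 1
  rw [mul_zero, zero_add] at h
  refine h.congr' ?_
  filter_upwards [self_mem_nhdsWithin] with p hp
  rw [div_mul_cancel₀ _ (cpow_half_ne_zero_of_mem_sector hp), sub_add_cancel]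

theorem tendsto_resolvent_div (hf : IsRootBranch ε f) :
    Tendsto (fun p => resolvent p (f p) / p.2 ^ (1 / 2 : ℂ)) (𝓝[sector ε] 0) (𝓝 (2 * I)) := by
  have hx := (fst_isBigO_sector.trans_isLittleO
    (snd_isLittleO_sector (ε := ε))).tendsto_div_nhds_zero
  have h := (hx.mul (hf.tendsto_one.pow 2)).add hf.tendsto_sub_one_div
  rw [zero_mul, zero_add] at h
  refine h.congr fun p => ?_
  rw [resolvent]
  ring

theorem eventuallyEq (hf : IsRootBranch ε f) (hg : IsRootBranch ε g) :
    f =ᶠ[𝓝[sector ε] 0] g := by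
  let Q : ℂ × ℂ → ℂ := fun p => (p.1 * (f p + g p) + 1)
    * (resolvent p (f p) / p.2 ^ (1 / 2 : ℂ) + resolvent p (g p) / p.2 ^ (1 / 2 : ℂ))
    + 4 * (p.2 / p.2 ^ (1 / 2 : ℂ))
  have hx : Tendsto (fun p : ℂ × ℂ => p.1) (𝓝[sector ε] 0) (𝓝 0) :=
    (continuous_fst.tendsto 0).mono_left nhdsWithin_le_nhds
  have hQ : Tendsto Q (𝓝[sector ε] 0) (𝓝 ((0 * (1 + 1) + 1) * (2 * I + 2 * I) + 4 * 0)) :=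
    (((hx.mul (hf.tendsto_one.add hg.tendsto_one)).add_const 1).mul
      (hf.tendsto_resolvent_div.add hg.tendsto_resolvent_div)).add
        (snd_isLittleO_sector.tendsto_div_nhds_zero.const_mul 4)
  have hlim : (0 * (1 + 1) + 1) * (2 * I + 2 * I) + 4 * 0 ≠ 0 := by
    ring_nf
    simp
  filter_upwards [hQ.eventually_ne hlim, self_mem_nhdsWithin] with p hp hps
  have hzf := isQuarticRoot_iff.1 (hf.root p hps.1)
  have hzg := isQuarticRoot_iff.1 (hg.root p hps.1)
  have hprod : (f p - g p) * Q p = 0 := by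
    have hs := cpow_half_ne_zero_of_mem_sector hps
    simp only [Q]
    field_simp
    simp only [resolvent] at hzf hzg ⊢
    linear_combination hzf - hzg
  exact sub_eq_zero.1 ((mul_eq_zero.1 hprod).resolve_right hp)

theorem eqOn (hf : IsRootBranch ε f) (hg : IsRootBranch ε g) : Set.EqOn f g (domY ε) := by
  rcases le_or_gt ε 0 with hε | hε
  · exact fun p hp => absurd ((norm_nonneg _).trans_lt hp.1) hε.not_gt
  have := nhdsWithin_sector_neBot hε
  obtain ⟨p, hp, hfg⟩ := (eventually_mem_nhdsWithin.and
    (eventually_eventually_nhdsWithin.2 (hf.eventuallyEq hg))).exists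
  rw [(isOpen_sector ε).nhdsWithin_eq hp] at hfg
  exact hf.analytic.eqOn_of_preconnected_of_eventuallyEq hg.analytic (isPreconnected_domY ε)
    hp.1 hfg

end IsRootBranch

end RootBranch

section Monodromy

open Complex (I)

theorem exp_mem_slitPlane_of_abs_im_lt {t : ℂ} (h : |t.im| < Real.pi) :
    Complex.exp t ∈ Complex.slitPlane := by
  obtain ⟨h₁, h₂⟩ := abs_lt.1 h
  rw [Complex.mem_slitPlane_iff_arg, ← Complex.log_im, Complex.log_exp h₁ h₂.le]
  exact ⟨h₂.ne, Complex.exp_ne_zero t⟩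

theorem exp_mem_ball_of_re_lt_log {R : ℝ} (hR : 0 < R) {t : ℂ} (ht : t.re < Real.log R) :
    Complex.exp t ∈ Metric.ball (0 : ℂ) R := by
  rw [mem_ball_zero_iff, Complex.norm_exp]
  exact (Real.lt_log_iff_exp_lt hR).1 ht

variable {R : ℝ}

theorem sum_exp_mul_eq_zero_of_sum_cpow_mul_eq_zero {ι : Type*} [Fintype ι] {α : ι → ℂ}
    {E : ι → ℂ → ℂ} (hR : 0 < R) (hE : ∀ i, AnalyticOnNhd ℂ (E i) (Metric.ball 0 R))
    (h : ∀ x ∈ Metric.ball (0 : ℂ) R, x ∈ Complex.slitPlane → ∑ i, x ^ α i * E i x = 0)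
    {t : ℂ} (ht : t.re < Real.log R) :
    ∑ i, Complex.exp (α i * t) * E i (Complex.exp t) = 0 := by
  let H : Set ℂ := {t | t.re < Real.log R}
  have hHo : IsOpen H := isOpen_lt Complex.continuous_re continuous_const
  have hHc : IsPreconnected H := (convex_halfSpace_re_lt _).isPreconnected
  have han : AnalyticOnNhd ℂ (fun t => ∑ i, Complex.exp (α i * t) * E i (Complex.exp t)) H :=
    fun t ht => Finset.analyticAt_fun_sum _ fun i _ =>
      (analyticAt_const.mul analyticAt_id).cexp.mul
        (AnalyticAt.comp (hE i _ (exp_mem_ball_of_re_lt_log hR ht)) analyticAt_id.cexp)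
  have ht₀ : ((Real.log R - 1 : ℝ) : ℂ) ∈ H := by
    change ((Real.log R - 1 : ℝ) : ℂ).re < Real.log R
    rw [Complex.ofReal_re]
    linarith
  have him : ∀ᶠ t : ℂ in 𝓝 ((Real.log R - 1 : ℝ) : ℂ), |t.im| < Real.pi :=
    Complex.continuous_im.abs.continuousAt.eventually_lt_const (by simp [Real.pi_pos])
  refine han.eqOn_zero_of_preconnected_of_eventuallyEq_zero hHc ht₀ ?_ ht
  filter_upwards [him, hHo.mem_nhds ht₀] with t htim htH
  have hlog : Complex.log (Complex.exp t) = t :=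
    Complex.log_exp (abs_lt.1 htim).1 (abs_lt.1 htim).2.le
  rw [Pi.zero_apply, ← h _ (exp_mem_ball_of_re_lt_log hR htH) (exp_mem_slitPlane_of_abs_im_lt htim)]
  refine Finset.sum_congr rfl fun i _ => ?_
  rw [Complex.cpow_def_of_ne_zero (Complex.exp_ne_zero t), hlog, mul_comm t]

theorem injective_exp_two_pi_I_mul {ι : Type*} {α : ι → ℂ}
    (hα : ∀ i j, i ≠ j → ∀ k : ℤ, α i - α j ≠ k) :
    Function.Injective fun i => Complex.exp (2 * Real.pi * I * α i) := by
  intro i j hij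
  by_contra hne
  obtain ⟨k, hk⟩ := Complex.exp_eq_exp_iff_exists_int.1 hij
  refine hα i j hne k (mul_left_cancel₀ Complex.two_pi_I_ne_zero ?_)
  linear_combination hk

theorem eqOn_zero_of_sum_cpow_mul_eq_zero {n : ℕ} {α : Fin n → ℂ}
    (hα : ∀ i j, i ≠ j → ∀ k : ℤ, α i - α j ≠ k) {E : Fin n → ℂ → ℂ}
    (hE : ∀ i, AnalyticOnNhd ℂ (E i) (Metric.ball 0 R))
    (h : ∀ x ∈ Metric.ball (0 : ℂ) R, x ∈ Complex.slitPlane → ∑ i, x ^ α i * E i x = 0)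
    (i : Fin n) : Set.EqOn (E i) 0 (Metric.ball 0 R) := by
  rcases le_or_gt R 0 with hR | hR
  · simp [Metric.ball_eq_empty.2 hR]
  have hne : ∀ x ∈ Metric.ball (0 : ℂ) R, x ≠ 0 → E i x = 0 := by
    intro x hx hx0
    have hre : (Complex.log x).re < Real.log R := by
      rw [Complex.log_re]
      exact Real.log_lt_log (norm_pos_iff.2 hx0) (mem_ball_zero_iff.1 hx)
    -- The `m`-th equation comes from turning `m` times around the origin.
    have hvandermonde : (fun i => Complex.exp (α i * Complex.log x) * E i x) = 0 := by
      refine Matrix.eq_zero_of_forall_pow_sum_mul_pow_eq_zero (injective_exp_two_pi_I_mul hα)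
        fun m => ?_
      have hm := sum_exp_mul_eq_zero_of_sum_cpow_mul_eq_zero hR hE h
        (t := Complex.log x + (m : ℕ) * (2 * Real.pi * I)) (by simpa using hre)
      rw [Complex.exp_add, Complex.exp_nat_mul_two_pi_mul_I, mul_one, Complex.exp_log hx0] at hm
      rw [← hm]
      refine Finset.sum_congr rfl fun i _ => ?_
      rw [← Complex.exp_nat_mul, mul_right_comm, ← Complex.exp_add]
      congr 2
      ring
    exact (mul_eq_zero.1 (congrFun hvandermonde i)).resolve_left (Complex.exp_ne_zero _)
  refine (hE i).eqOn_zero_of_preconnected_of_frequently_eq_zero (convex_ball _ _).isPreconnected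
    (Metric.mem_ball_self hR) (Eventually.frequently ?_)
  filter_upwards [self_mem_nhdsWithin, mem_nhdsWithin_of_mem_nhds (Metric.ball_mem_nhds 0 hR)]
    with x hx0 hx
  exact hne x hx hx0

end Monodromy

section Basis

open Complex (I)

variable {r : ℂ} {ε : ℝ}

theorem domXY_mono {R : ℝ} (h : ε ≤ R) : domXY ε ⊆ domXY R := fun _ hp =>
  ⟨⟨hp.1.1.trans_le h, hp.1.2.1.trans_le h, hp.1.2.2⟩, hp.2⟩

theorem isPreconnected_domXY (ε : ℝ) : IsPreconnected (domXY ε) := by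
  have hprod : domXY ε = (Metric.ball (0 : ℂ) ε ∩ Complex.slitPlane)
      ×ˢ (Metric.ball (0 : ℂ) ε ∩ Complex.slitPlane) := by
    ext p
    simp [domXY, domY]
    tauto
  rw [hprod]
  exact (isPreconnected_ball_inter_slitPlane ε).prod (isPreconnected_ball_inter_slitPlane ε)

theorem nonempty_domXY (hε : 0 < ε) : (domXY ε).Nonempty := by
  have hnorm : ‖((ε / 2 : ℝ) : ℂ)‖ < ε := by
    rw [Complex.norm_real, Real.norm_of_nonneg (half_pos hε).le]
    exact half_lt_self hε
  have hslit := Complex.ofReal_mem_slitPlane.2 (half_pos hε)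
  exact ⟨((ε / 2 : ℝ), (ε / 2 : ℝ)), ⟨hnorm, hnorm, hslit⟩, hslit⟩

theorem eqOn_zero_of_re_pos {g : ℂ × ℂ → ℂ} (hg : AnalyticOnNhd ℂ g (sqrtDisc ε))
    (h : ∀ q ∈ sqrtDisc ε, 0 < q.2.re → g q = 0) : Set.EqOn g 0 (sqrtDisc ε) := by
  rcases le_or_gt ε 0 with hε | hε
  · exact fun q hq => absurd ((norm_nonneg _).trans_lt hq.1) hε.not_gt
  obtain ⟨t, ht0, htε⟩ := exists_between (Real.sqrt_pos.2 hε)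
  have ht : ((0, t) : ℂ × ℂ) ∈ sqrtDisc ε := by
    refine ⟨by simpa, ?_⟩
    rw [Complex.norm_real, Real.norm_of_nonneg ht0.le]
    exact (Real.lt_sqrt ht0.le).1 htε
  refine hg.eqOn_zero_of_preconnected_of_eventuallyEq_zero (isPreconnected_sqrtDisc ε) ht ?_
  have hre : ∀ᶠ q : ℂ × ℂ in 𝓝 (0, (t : ℂ)), 0 < q.2.re :=
    (Complex.continuous_re.comp continuous_snd).continuousAt.eventually_const_lt (by simpa)
  filter_upwards [(isOpen_sqrtDisc ε).mem_nhds ht, hre] with q hq hq0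
  exact h q hq hq0

/-- The factor of `Φ_i` in front of its power of `x`. It is holomorphic in `x` and `s = √y`, with
odd powers of `s` for `Φ₂` and `Φ₄` and even ones for `Φ₁` and `Φ₃`. -/
noncomputable def phiFactor (r : ℂ) (i : Fin 4) (q : ℂ × ℂ) : ℂ :=
  q.2 ^ (![0, 1, 0, 1] i : ℕ) * doubleSeries (phiCoeff r i) (q.1, q.2 ^ 2)

theorem Phi_sq (r : ℂ) (i : Fin 4) {q : ℂ × ℂ} (hs : 0 < q.2.re) :
    Phi r i (q.1, q.2 ^ 2) = q.1 ^ phiExpX r i * phiFactor r i q := by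
  have hpow : (q.2 ^ 2) ^ phiExpY i = q.2 ^ (![0, 1, 0, 1] i : ℕ) := by
    fin_cases i <;> simp [phiExpY, Complex.sq_cpow_two_inv hs]
  rw [Phi_eq_frobenius, frobenius, phiFactor, hpow, mul_assoc]

theorem analyticOnNhd_phiFactor (hr : ∀ k : ℤ, 2 * r ≠ k) (hε : ε ≤ 256⁻¹) (i : Fin 4) :
    AnalyticOnNhd ℂ (phiFactor r i) (sqrtDisc ε) := fun q hq => by
  have hseries : AnalyticAt ℂ (doubleSeries (phiCoeff r i)) (q.1, q.2 ^ 2) :=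
    (convergesBelow_phiCoeff hr i).analyticAt (hq.1.trans_le hε)
      ((norm_pow q.2 2).trans_lt (hq.2.trans_le hε))
  exact (analyticAt_snd.pow _).mul (AnalyticAt.comp (f := fun q : ℂ × ℂ => (q.1, q.2 ^ 2)) hseries
    (analyticAt_fst.prod (analyticAt_snd.pow 2)))

theorem doubleSeries_zero (a : ℕ × ℕ → ℂ) : doubleSeries a (0, 0) = a (0, 0) := by
  rw [doubleSeries, tsum_eq_single (0, 0)]
  · simp
  · rintro ⟨m, n⟩ hk
    rcases m with _ | m
    · rcases n with _ | n
      · exact absurd rfl hk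
      · simp
    · simp

theorem phiFactor_zero (r : ℂ) (i : Fin 4) : phiFactor r i 0 = ![1, 0, 1, 0] i := by
  have h0 (i : Fin 4) : doubleSeries (phiCoeff r i) (0, 0) = 1 := by
    rw [doubleSeries_zero, phiCoeff_zero]
  fin_cases i <;> simp [phiFactor, h0]

theorem hasDerivAt_phiFactor (hr : ∀ k : ℤ, 2 * r ≠ k) (i : Fin 4) :
    HasDerivAt (fun s => phiFactor r i (0, s)) (![0, 1, 0, 1] i) 0 := by
  have hseries : HasDerivAt (fun s : ℂ => doubleSeries (phiCoeff r i) (0, s ^ 2)) 0 0 := by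
    have h := hasDerivAt_slice_snd (p := (0, 0)) ((convergesBelow_phiCoeff hr i).analyticAt
      (p := (0, 0)) (by simp) (by simp)).differentiableAt
    have hpow := hasDerivAt_pow 2 (0 : ℂ)
    exact (h.comp_of_eq (0 : ℂ) hpow (by simp)).congr_deriv (by simp)
  have h := (hasDerivAt_pow (![0, 1, 0, 1] i) (0 : ℂ)).mul hseries
  refine h.congr_deriv ?_
  fin_cases i <;> simp [doubleSeries_zero, phiCoeff_zero]

section Coefficients

variable {g : ℂ × ℂ → ℂ} {c : Fin 4 → ℂ}

theorem exponent_sub_ne_intCast (hr : ∀ k : ℤ, 2 * r ≠ k) (i j : Fin 3) (hij : i ≠ j) (k : ℤ) :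
    ![0, -r, -r + 1 / 2] i - ![0, -r, -r + 1 / 2] j ≠ k := by
  have hhalf : ∀ k : ℤ, (1 / 2 : ℂ) ≠ k := fun k h => by
    have : (1 : ℤ) = 2 * k := by
      exact_mod_cast (by linear_combination 2 * h : (1 : ℂ) = 2 * k)
    omega
  wlog hlt : i < j generalizing i j k
  · intro h
    refine this j i hij.symm (-k) (lt_of_le_of_ne (not_lt.1 hlt) hij.symm) ?_
    rw [Int.cast_neg, ← h, neg_sub]
  have h₀₁ : (0 : ℂ) - -r ≠ k := fun h => hr (2 * k) (by push_cast; linear_combination 2 * h)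
  have h₀₂ : (0 : ℂ) - (-r + 1 / 2) ≠ k := fun h =>
    hr (2 * k + 1) (by push_cast; linear_combination 2 * h)
  have h₁₂ : -r - (-r + 1 / 2) ≠ k := fun h => hhalf (-k) (by push_cast; linear_combination -h)
  fin_cases i <;> fin_cases j <;>
    first | exact absurd hlt (by decide) | exact h₀₁ | exact h₀₂ | exact h₁₂

theorem eq_phiFactor_of_eq_sum_Phi (hr : ∀ k : ℤ, 2 * r ≠ k) (hε : ε ≤ 256⁻¹)
    (hg : AnalyticOnNhd ℂ g (sqrtDisc ε))
    (h : ∀ q ∈ sqrtDisc ε, q.1 ∈ Complex.slitPlane → 0 < q.2.re →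
      g q = ∑ i, c i * Phi r i (q.1, q.2 ^ 2)) :
    ∀ q ∈ sqrtDisc ε, g q = c 0 * phiFactor r 0 q + c 1 * phiFactor r 1 q ∧
      c 2 * phiFactor r 2 q = 0 ∧ c 3 * phiFactor r 3 q = 0 := by
  let E : Fin 3 → ℂ × ℂ → ℂ := ![fun q => c 0 * phiFactor r 0 q + c 1 * phiFactor r 1 q - g q,
    fun q => c 2 * phiFactor r 2 q, fun q => c 3 * phiFactor r 3 q]
  have hE : ∀ j, AnalyticOnNhd ℂ (E j) (sqrtDisc ε) := by
    have hphi := fun i q hq => (analyticAt_const (v := c i)).mul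
      (analyticOnNhd_phiFactor hr hε i q hq)
    intro j q hq
    fin_cases j
    · exact ((hphi 0 q hq).add (hphi 1 q hq)).sub (hg q hq)
    · exact hphi 2 q hq
    · exact hphi 3 q hq
  have hzero : ∀ j, Set.EqOn (E j) 0 (sqrtDisc ε) := fun j => by
    refine eqOn_zero_of_re_pos (hE j) fun q hq hs => ?_
    refine eqOn_zero_of_sum_cpow_mul_eq_zero (exponent_sub_ne_intCast hr)
      (E := fun j x => E j (x, q.2)) (R := ε)
      (fun j x hx => ?_) (fun x hx hxs => ?_) j (mem_ball_zero_iff.2 hq.1)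
    · exact AnalyticAt.comp (f := fun x => (x, q.2))
        (hE j (x, q.2) ⟨mem_ball_zero_iff.1 hx, hq.2⟩) (analyticAt_id.prod analyticAt_const)
    · have hsum := h (x, q.2) ⟨mem_ball_zero_iff.1 hx, hq.2⟩ hxs hs
      simp only [Fin.sum_univ_four, Phi_sq (q := (x, q.2)) r _ hs] at hsum
      simp [Fin.sum_univ_three, E, hsum, phiExpX]
      ring
  exact fun q hq => ⟨(sub_eq_zero.1 (hzero 0 hq)).symm, hzero 1 hq, hzero 2 hq⟩

theorem coeff_eq_of_eq_sum_Phi (hr : ∀ k : ℤ, 2 * r ≠ k) (hε : 0 < ε) (hε' : ε ≤ 256⁻¹)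
    (hg : AnalyticOnNhd ℂ g (sqrtDisc ε))
    (h : ∀ q ∈ sqrtDisc ε, q.1 ∈ Complex.slitPlane → 0 < q.2.re →
      g q = ∑ i, c i * Phi r i (q.1, q.2 ^ 2)) :
    c = ![g 0, deriv (fun s => g (0, s)) 0, 0, 0] := by
  have hfactor := eq_phiFactor_of_eq_sum_Phi hr hε' hg h
  have h0 := zero_mem_sqrtDisc hε
  have hnear : ∀ᶠ s : ℂ in 𝓝 0, ((0, s) : ℂ × ℂ) ∈ sqrtDisc ε :=
    (Continuous.prodMk_right (0 : ℂ)).continuousAt.eventually_mem ((isOpen_sqrtDisc ε).mem_nhds h0)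
  have hg' : HasDerivAt (fun s => g (0, s)) (c 1) 0 := by
    have hd := ((hasDerivAt_phiFactor hr 0).const_mul (c 0)).add
      ((hasDerivAt_phiFactor hr 1).const_mul (c 1))
    refine (hd.congr_of_eventuallyEq (hnear.mono fun s hs => (hfactor _ hs).1)).congr_deriv ?_
    simp
  have hc₃ : HasDerivAt (fun _ : ℂ => (0 : ℂ)) (c 3) 0 := by
    refine (((hasDerivAt_phiFactor hr 3).const_mul (c 3)).congr_of_eventuallyEq
      (hnear.mono fun s hs => (hfactor _ hs).2.2.symm)).congr_deriv ?_
    simp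
  ext i
  fin_cases i
  · simpa [phiFactor_zero] using (hfactor 0 h0).1.symm
  · exact hg'.deriv.symm
  · simpa [phiFactor_zero] using (hfactor 0 h0).2.1
  · exact hc₃.unique (hasDerivAt_const 0 0)

end Coefficients

theorem eq_zero_of_sum_Phi_eq_zero (hr : ∀ k : ℤ, 2 * r ≠ k) {U : Set (ℂ × ℂ)} (hU : IsOpen U)
    (hUne : U.Nonempty) (hUs : U ⊆ domXY 256⁻¹) {c : Fin 4 → ℂ}
    (h : ∀ p ∈ U, ∑ i, c i * Phi r i p = 0) : c = 0 := by
  obtain ⟨p, hp⟩ := hUne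
  have hzero : Set.EqOn (fun p => ∑ i, c i * Phi r i p) 0 (domXY 256⁻¹) :=
    (IsHornSolution.sum (isHornSolution_Phi hr)
      c).analytic.eqOn_zero_of_preconnected_of_eventuallyEq_zero (isPreconnected_domXY _) (hUs hp)
      (eventually_of_mem (hU.mem_nhds hp) h)
  have hc := coeff_eq_of_eq_sum_Phi (c := c) hr (by norm_num) le_rfl
    (analyticOnNhd_const (v := (0 : ℂ))) fun q hq hx hs =>
      (hzero ⟨prodMk_sq_mem_domY hq hs, hx⟩).symm
  rw [hc]
  ext i
  fin_cases i <;> simp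

theorem jet_sum {ι : Type*} [Fintype ι] {F : ι → ℂ × ℂ → ℂ} {p : ℂ × ℂ} (c : ι → ℂ)
    (hF : ∀ i, AnalyticAt ℂ (F i) p) :
    jet (fun q => ∑ i, c i * F i q) p = ∑ i, c i • jet (F i) p := by
  ext k
  rw [Finset.sum_apply]
  fin_cases k
  · rfl
  · simp [jet, thetaX_eq_thetaLin, thetaLin_sum _ _ _ c fun i => (hF i).differentiableAt]
  · simp [jet, thetaY_eq_thetaLin, thetaLin_sum _ _ _ c fun i => (hF i).differentiableAt]
  · simp [jet, thetaX_eq_thetaLin, thetaY_eq_thetaLin, thetaLin_thetaLin_sum _ _ _ _ _ _ c hF]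

theorem jet_sub {F G : ℂ × ℂ → ℂ} {p : ℂ × ℂ} (hF : AnalyticAt ℂ F p) (hG : AnalyticAt ℂ G p) :
    jet (fun q => F q - G q) p = jet F p - jet G p := by
  have h := jet_sum (F := ![F, G]) (p := p) ![1, -1] (by intro i; fin_cases i <;> assumption)
  simpa [Fin.sum_univ_two, sub_eq_add_neg] using h

theorem IsHornSolution.eqOn_zero_of_jet_eq_zero_of_subset_domXY {a b c : ℂ}
    {U : Set (ℂ × ℂ)} {F : ℂ × ℂ → ℂ} (hF : IsHornSolution a b c U F) (hU : IsOpen U)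
    (hUc : IsPreconnected U) (hUs : U ⊆ domXY 256⁻¹) {p : ℂ × ℂ} (hp : p ∈ U) (h0 : jet F p = 0) :
    Set.EqOn F 0 U :=
  hF.eqOn_zero_of_jet_eq_zero hU hUc hp (Complex.slitPlane_ne_zero (hUs hp).2)
    (Complex.slitPlane_ne_zero (hUs hp).1.2.2)
    (det_secondOrderMatrix_ne_zero (hUs hp).1.1 (hUs hp).1.2.1)
    (det_thirdOrderMatrix_ne_zero (hUs hp).1.1 (hUs hp).1.2.1) h0

theorem linearIndependent_jet_Phi (hr : ∀ k : ℤ, 2 * r ≠ k) {p : ℂ × ℂ} (hp : p ∈ domXY 256⁻¹) :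
    LinearIndependent ℂ fun i => jet (Phi r i) p := by
  refine Fintype.linearIndependent_iff.2 fun c hc => congrFun ?_
  refine eq_zero_of_sum_Phi_eq_zero hr (isOpen_domXY _) ⟨p, hp⟩ subset_rfl
    ((IsHornSolution.sum (isHornSolution_Phi hr) c).eqOn_zero_of_jet_eq_zero_of_subset_domXY
      (isOpen_domXY _) (isPreconnected_domXY _) subset_rfl hp ?_)
  rw [jet_sum c fun i => (isHornSolution_Phi hr i).analytic p hp, hc]

theorem existsUnique_coefficients (hr : ∀ k : ℤ, 2 * r ≠ k) {U : Set (ℂ × ℂ)} (hU : IsOpen U)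
    (hUc : IsConnected U) (hUs : U ⊆ domXY 256⁻¹) {F : ℂ × ℂ → ℂ}
    (hF : IsHornSolution r (-r) (1 / 2) U F) :
    ∃! c : Fin 4 → ℂ, ∀ p ∈ U, F p = ∑ i, c i * Phi r i p := by
  obtain ⟨p, hp⟩ := hUc.nonempty
  have hPhi := fun i => (isHornSolution_Phi hr i).mono hUs
  obtain ⟨c, hc⟩ : ∃ c : Fin 4 → ℂ, ∑ i, c i • jet (Phi r i) p = jet F p := by
    rw [← Submodule.mem_span_range_iff_exists_fun,
      (linearIndependent_jet_Phi hr (hUs hp)).span_eq_top_of_card_eq_finrank' (by simp)]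
    trivial
  have hcomb := IsHornSolution.sum hPhi c
  have hjet : jet (fun q => F q - ∑ i, c i * Phi r i q) p = 0 := by
    rw [jet_sub (hF.analytic p hp) (hcomb.analytic p hp),
      jet_sum c fun i => (hPhi i).analytic p hp, hc, sub_self]
  have hzero := (hF.sub hcomb).eqOn_zero_of_jet_eq_zero_of_subset_domXY hU hUc.isPreconnected hUs
    hp hjet
  refine ⟨c, fun q hq => sub_eq_zero.1 (hzero hq), fun d hd => sub_eq_zero.1 ?_⟩
  refine eq_zero_of_sum_Phi_eq_zero hr hU hUc.nonempty hUs fun q hq => ?_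
  simp only [Pi.sub_apply, sub_mul, Finset.sum_sub_distrib]
  rw [← hd q hq, sub_eq_zero.1 (hzero hq), sub_self]

end Basis

section Formula

open Complex (I)

variable {r : ℂ} {ε : ℝ} {f v : ℂ × ℂ → ℂ}

theorem re_cpow_half_pos {y : ℂ} (hy : y ∈ Complex.slitPlane) : 0 < (y ^ (1 / 2 : ℂ)).re := by
  have him : (Complex.log y * (1 / 2)).im = y.arg / 2 := by
    rw [show (1 / 2 : ℂ) = ((1 / 2 : ℝ) : ℂ) by norm_num, Complex.im_mul_ofReal, Complex.log_im]
    ring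
  rw [Complex.cpow_def_of_ne_zero (Complex.slitPlane_ne_zero hy), Complex.exp_re, him]
  have hlt := (Complex.mem_slitPlane_iff_arg.1 hy).1
  have hle := Complex.arg_le_pi y
  have hgt := Complex.neg_pi_lt_arg y
  refine mul_pos (Real.exp_pos _) (Real.cos_pos_of_mem_Ioo ⟨by linarith, ?_⟩)
  linarith [hle.lt_of_ne hlt]

namespace IsRootBranch

theorem eqOn_rootOf (hf : IsRootBranch ε f) (hv : IsRootSqrt ε v) :
    Set.EqOn f (rootOf v) (domY ε) := fun _ hp =>
  hf.eqOn (isRootBranch_rootOf hv ((norm_nonneg _).trans_lt hp.1)) hp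

theorem mem_slitPlane (hf : IsRootBranch ε f) (hv : IsRootSqrt ε v) {p : ℂ × ℂ}
    (hp : p ∈ domY ε) : f p ∈ Complex.slitPlane :=
  hf.eqOn_rootOf hv hp ▸ sq_mem_slitPlane (hv.re_pos _ (prodMk_cpow_half_mem_sqrtDisc hp))

theorem isHornSolution_cpow (hf : IsRootBranch ε f) (hv : IsRootSqrt ε v) (r : ℂ) :
    IsHornSolution r (-r) (1 / 2) (domY ε) fun p => f p ^ r := by
  have hne {p : ℂ × ℂ} (hp : p ∈ domY ε) : f p ≠ 0 :=
    Complex.slitPlane_ne_zero (hf.mem_slitPlane hv hp)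
  refine (isHornSolution_cexp_mul_log r (isOpen_domY ε)
    (fun p hp => (hf.analytic p hp).clog (hf.mem_slitPlane hv hp))
    fun p hp => ?_).congr (isOpen_domY ε) fun p hp => ?_
  · simpa only [Complex.exp_log (hne hp)] using hf.root p hp
  · rw [Complex.cpow_def_of_ne_zero (hne hp), mul_comm]

end IsRootBranch

theorem IsRootSqrt.hasDerivAt_sq_cpow (hv : IsRootSqrt ε v) (hε : 0 < ε) (r : ℂ) :
    HasDerivAt (fun s => (v (0, s) ^ 2) ^ r) (2 * I * r) 0 := by
  have h0 := zero_mem_sqrtDisc hε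
  have hslice : HasDerivAt (fun s => v (0, s)) (deriv (fun s => v (0, s)) 0) 0 :=
    (AnalyticAt.comp (f := fun s : ℂ => ((0 : ℂ), s)) (hv.analytic 0 h0)
      (analyticAt_const.prod analyticAt_id)).differentiableAt.hasDerivAt
  have hsq : HasDerivAt (fun s => v (0, s) ^ 2) (2 * I) 0 := by
    have hd : HasDerivAt (fun s : ℂ => 1 + 2 * I * (s * v (0, s))) (2 * I) 0 := by
      refine ((((hasDerivAt_id (0 : ℂ)).mul hslice).const_mul (2 * I)).const_add 1).congr_deriv ?_
      simp [show v (0, 0) = 1 from hv.map_zero hε]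
    refine hd.congr_of_eventuallyEq ?_
    filter_upwards [(Continuous.prodMk_right (0 : ℂ)).continuousAt.eventually_mem
      ((isOpen_sqrtDisc ε).mem_nhds h0)] with s hs
    linear_combination hv.root _ hs
  refine (hsq.cpow_const (c := r) (sq_mem_slitPlane (hv.re_pos 0 h0))).congr_deriv ?_
  simp [show v (0, 0) = 1 from hv.map_zero hε]
  ring

theorem IsRootBranch.cpow_eq_Phi_add_Phi (hr : ∀ k : ℤ, 2 * r ≠ k) (hf : IsRootBranch ε f)
    (hv : IsRootSqrt ε v) (hε : ε ≤ 256⁻¹) {p : ℂ × ℂ} (hp : p ∈ domY ε) :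
    f p ^ r = Phi1 r p + 2 * I * r * Phi2 r p := by
  have hε0 : 0 < ε := (norm_nonneg _).trans_lt hp.1
  obtain ⟨c, hc, -⟩ := existsUnique_coefficients hr (isOpen_domXY ε)
    ⟨nonempty_domXY hε0, isPreconnected_domXY ε⟩ (domXY_mono hε)
    ((hf.isHornSolution_cpow hv r).mono fun _ hq => hq.1)
  have hg : AnalyticOnNhd ℂ (fun q => (v q ^ 2) ^ r) (sqrtDisc ε) := fun q hq =>
    ((hv.analytic q hq).pow 2).cpow analyticAt_const (sq_mem_slitPlane (hv.re_pos q hq))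
  have hsum : ∀ q ∈ sqrtDisc ε, q.1 ∈ Complex.slitPlane → 0 < q.2.re →
      (v q ^ 2) ^ r = ∑ i, c i * Phi r i (q.1, q.2 ^ 2) := fun q hq hx hs => by
    have hqs := prodMk_sq_mem_domY hq hs
    rw [← hc _ ⟨hqs, hx⟩, hf.eqOn_rootOf hv hqs, rootOf, one_div, Complex.sq_cpow_two_inv hs]
  have hcoeff := coeff_eq_of_eq_sum_Phi hr hε0 hε hg hsum
  have hc0 : c 0 = 1 := by simp [hcoeff, hv.map_zero hε0]
  have hc1 : c 1 = 2 * I * r := by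
    rw [hcoeff]
    exact (hv.hasDerivAt_sq_cpow hε0 r).deriv
  have hfactor := (eq_phiFactor_of_eq_sum_Phi hr hε hg hsum _
    (prodMk_cpow_half_mem_sqrtDisc hp)).1
  have hPhi (i : Fin 4) := Phi_sq r i (q := (p.1, p.2 ^ (1 / 2 : ℂ))) (re_cpow_half_pos hp.2.2)
  have hPhi1 : Phi1 r p = phiFactor r 0 (p.1, p.2 ^ (1 / 2 : ℂ)) := by
    simpa [phiExpX, Phi, cpow_half_sq, -one_div] using hPhi 0
  have hPhi2 : Phi2 r p = phiFactor r 1 (p.1, p.2 ^ (1 / 2 : ℂ)) := by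
    simpa [phiExpX, Phi, cpow_half_sq, -one_div] using hPhi 1
  rw [hf.eqOn_rootOf hv hp, rootOf, hfactor, hc0, hc1, hPhi1, hPhi2, one_mul]

end Formula

end HornH5

theorem mainTheorem9 :
    -- any branch of `f ^ r`, for any holomorphic root `f` on any open set, solves the system
    (∀ (r : ℂ) (U : Set (ℂ × ℂ)) (f L : ℂ × ℂ → ℂ), IsOpen U →
      AnalyticOnNhd ℂ f U → (∀ p ∈ U, HornH5.IsQuarticRoot p (f p)) →
      AnalyticOnNhd ℂ L U → (∀ p ∈ U, Complex.exp (L p) = f p) →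
      HornH5.IsHornSolution r (-r) (1 / 2) U (fun p => Complex.exp (r * L p))) ∧
    ∃ ε : ℝ, 0 < ε ∧
      -- the branch of the root near the origin exists and is unique
      (∃ f : ℂ × ℂ → ℂ, HornH5.IsRootBranch ε f) ∧
      (∀ f g : ℂ × ℂ → ℂ, HornH5.IsRootBranch ε f → HornH5.IsRootBranch ε g →
        Set.EqOn f g (HornH5.domY ε)) ∧
      ∀ r : ℂ, (∀ k : ℤ, 2 * r ≠ (k : ℂ)) →
        -- convergence of the four series
        (∀ x y : ℂ, ‖x‖ < ε → ‖y‖ < ε →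
          Summable (HornH5.H5Term r (-r) (1 / 2) x y) ∧
          Summable (HornH5.H5Term (r + 1 / 2) (-r + 1 / 2) (3 / 2) x y) ∧
          Summable (HornH5.Phi3Term r x y) ∧
          Summable (HornH5.Phi4Term r x y)) ∧
        -- `Φ₁, …, Φ₄` form a basis of the local solution space, which has rank 4
        (∀ U : Set (ℂ × ℂ), IsOpen U → IsConnected U → U ⊆ HornH5.domXY ε →
          (∀ i, HornH5.IsHornSolution r (-r) (1 / 2) U (HornH5.Phi r i)) ∧
          ∀ F : ℂ × ℂ → ℂ, HornH5.IsHornSolution r (-r) (1 / 2) U F →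
            ∃! c : Fin 4 → ℂ, ∀ p ∈ U, F p = ∑ i, c i * HornH5.Phi r i p) ∧
        -- `f ^ r` solves the system and equals `Φ₁ + 2ir Φ₂`
        ∀ f : ℂ × ℂ → ℂ, HornH5.IsRootBranch ε f →
          HornH5.IsHornSolution r (-r) (1 / 2) (HornH5.domY ε) (fun p => f p ^ r) ∧
          ∀ p ∈ HornH5.domY ε,
            f p ^ r = HornH5.Phi1 r p + 2 * Complex.I * r * HornH5.Phi2 r p := by
  refine ⟨fun r U f L hU _ hroot hL hexp =>
    HornH5.isHornSolution_cexp_mul_log r hU hL fun p hp => (hexp p hp).symm ▸ hroot p hp, ?_⟩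
  obtain ⟨ε, hε, hε', v, hv⟩ := HornH5.exists_isRootSqrt (R := 256⁻¹) (by norm_num)
  have hmono := HornH5.domXY_mono hε'
  refine ⟨ε, hε, ⟨_, HornH5.isRootBranch_rootOf hv hε⟩, fun f g hf hg => hf.eqOn hg,
    fun r hr => ⟨fun x y hx hy => ?_, fun U hU hUc hUs => ⟨fun i => ?_, fun F hF => ?_⟩,
      fun f hf => ⟨hf.isHornSolution_cpow hv r, fun p hp => ?_⟩⟩⟩
  · exact HornH5.summable_Phi_terms hr (hx.trans_le hε') (hy.trans_le hε')
  · exact (HornH5.isHornSolution_Phi hr i).mono (hUs.trans hmono)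
  · exact HornH5.existsUnique_coefficients hr hU hUc (hUs.trans hmono) hF
  · exact hf.cpow_eq_Phi_add_Phi hr hv hε' hp
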